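/- Let $p$ be a prime number and let $O$ be a Noetherian integral domain of characteristic $0$. All group schemes are commutative. Let $\mathscr{C}$ be a full subcategory of the category of finite flat commutative group schemes of $p$-power order over $O$ that is closed under taking (binary) products, closed flat subgroup schemes, and quotients by closed flat subgroup schemes. For group schemes $A,B$ in $\mathscr{C}$ let $\operatorname{Ext}^1_{\mathscr{C}}(A,B)$ be the group of equivalence classes of extensions $0\to B\to E\to A\to 0$ with $E$ in $\mathscr{C}$. Let $\{G_i\}_{i\in I}$ be a finite family of $p$-divisible groups over $O$ such that, for each $i\in I$: - the endomorphism ring $R_i=\operatorname{End}(G_i)$ is a discrete valuation ring, with uniformizer $\pi_i$ and residue field $k_i=R_i/\pi_iR_i$; - for every $n$ the group scheme $G_i[\pi_i^n]=\ker(\pi_i^n\colon G_i\to G_i)$ is an object of $\mathscr{C}$; - the connecting map $$\delta\colon \operatorname{Hom}_O(G_i[\pi_i],G_i[\pi_i])\longrightarrow \operatorname{Ext}^1_{\mathscr{C}}(G_i[\pi_i],G_i[\pi_i])$$ associated to the exact sequence $0\to G_i[\pi_i]\to G_i[\pi_i^2]\xrightarrow{\ \pi_i\ }G_i[\pi_i]\to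 0$, which sends $f$ to the class of the pullback of this sequence along $f$, is an isomorphism of $1$-dimensional $k_i$-vector spaces; - for each $j\in I$ with $j\neq i$, the groups $\operatorname{Ext}^1_{\mathscr{C}}(G_i[\pi_i],G_j[\pi_j])$ and $\operatorname{Ext}^1_{\mathscr{C}}(G_j[\pi_j],G_i[\pi_i])$ are trivial. Let $X$ be an object of $\mathscr{C}$ that admits a filtration $0=X_0\subset X_1\subset\dots\subset X_m=X$ by closed flat subgroup schemes such that each successive quotient $X_{t}/X_{t-1}$ is isomorphic to $G_i[\pi_i]$ for some $i\in I$. Then there are an integer $r\ge 0$, indices $i_1,\dots,i_r\in I$ and integers $n_1,\dots,n_r\ge 1$ such that $$X\;\cong\;\bigoplus_{s=1}^{r} G_{i_s}[\pi_{i_s}^{\,n_s}].$$ -/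

import Mathlib

open CategoryTheory Limits AlgebraicGeometry MonoidalCategory CartesianMonoidalCategory

universe u v w

noncomputable section

/-! ### Commutative group objects form an additive category with limits -/

namespace CategoryTheory.CommGrp

open scoped CategoryTheory.MonObj

variable {C : Type u} [Category.{v} C] [CartesianMonoidalCategory C] [BraidedCategory C]

instance homAdd (A B : CommGrp C) : Add (A ⟶ B) :=
  ⟨fun f g => InducedCategory.homMk (f.hom * g.hom)⟩

instance homZero (A B : CommGrp C) : Zero (A ⟶ B) := ⟨InducedCategory.homMk 1⟩

instance homNeg (A B : CommGrp C) : Neg (A ⟶ B) := ⟨fun f => InducedCategory.homMk f.hom⁻¹⟩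

/-- Homomorphisms into a commutative group object are added pointwise, through the group law of
the target (which Mathlib writes multiplicatively). -/
instance homAddCommGroup (A B : CommGrp C) : AddCommGroup (A ⟶ B) where
  nsmul := nsmulRec
  zsmul := zsmulRec
  add_assoc f g h := InducedCategory.hom_ext (mul_assoc f.hom g.hom h.hom)
  zero_add f := InducedCategory.hom_ext (one_mul f.hom)
  add_zero f := InducedCategory.hom_ext (mul_one f.hom)
  neg_add_cancel f := InducedCategory.hom_ext (inv_mul_cancel f.hom)
  add_comm f g := InducedCategory.hom_ext (mul_comm f.hom g.hom)

theorem hom_add {A B : CommGrp C} (f g : A ⟶ B) :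
    (f + g).hom.hom.hom = f.hom.hom.hom * g.hom.hom.hom := rfl

instance preadditive : Preadditive (CommGrp C) where
  add_comp A B D f g h := by
    apply CommGrp.hom_ext
    simp [hom_add, MonObj.mul_comp]
  comp_add A B D f g h := by
    apply CommGrp.hom_ext
    simp [hom_add, MonObj.comp_mul]

section Limits

variable {J : Type w} [Category J] [HasLimitsOfShape J C]

/-- A limit of commutative group objects is commutative. -/
theorem isCommMonObj_limit (F : J ⥤ CommGrp C) :
    IsCommMonObj (limit (F ⋙ forget₂Grp C)).X := by
  rw [isCommMonObj_iff_isMulCommutative]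
  refine fun X => ⟨⟨fun f g => ?_⟩⟩
  have hl := isLimitOfPreserves (Grp.forget C) (limit.isLimit (F ⋙ forget₂Grp C))
  refine hl.hom_ext fun j => ?_
  have hc : IsCommMonObj ((F ⋙ forget₂Grp C).obj j).X := (F.obj j).comm
  change (f * g) ≫ (limit.π (F ⋙ forget₂Grp C) j).hom.hom =
    (g * f) ≫ (limit.π (F ⋙ forget₂Grp C) j).hom.hom
  rw [MonObj.mul_comp, MonObj.mul_comp, mul_comm]

instance hasLimitsOfShape : HasLimitsOfShape J (CommGrp C) where
  has_limit F := by
    let L : CommGrp C :=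
      { X := (limit (F ⋙ forget₂Grp C)).X
        comm := isCommMonObj_limit F }
    have : CreatesLimit F (forget₂Grp C) :=
      createsLimitOfFullyFaithfulOfIso L (Iso.refl _)
    exact hasLimit_of_created F (forget₂Grp C)

end Limits

end CategoryTheory.CommGrp

/-! ### Finite flat commutative group schemes over a ring -/

/-- Commutative group schemes over `Spec O`, with homomorphisms of group schemes over `O`. -/
abbrev CommGroupScheme (O : Type u) [CommRing O] : Type (u + 1) :=
  CommGrp (Over (Spec (CommRingCat.of O)))

namespace CommGroupScheme

variable {O : Type u} [CommRing O]

instance hasFiniteLimits : HasFiniteLimits (CommGroupScheme O) where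
  out _ _ _ := inferInstance

instance hasFiniteBiproducts : HasFiniteBiproducts (CommGroupScheme O) :=
  HasFiniteBiproducts.of_hasFiniteProducts

/-- The structure morphism `X ⟶ Spec O` of a group scheme. -/
abbrev structureMap (X : CommGroupScheme O) : X.X.left ⟶ Spec (CommRingCat.of O) := X.X.hom

/-- The morphism of schemes underlying a homomorphism of group schemes. -/
abbrev schemeMap {X Y : CommGroupScheme O} (f : X ⟶ Y) : X.X.left ⟶ Y.X.left := f.hom.hom.hom.left

/-- `X` is finite and flat over `O`. -/
structure IsFiniteFlat (X : CommGroupScheme O) : Prop where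
  finite : IsFinite X.structureMap
  flat : Flat X.structureMap

/-- `X` has order `m`: its structure morphism has constant rank `m`. -/
def HasOrder (X : CommGroupScheme O) (m : ℕ) : Prop :=
  ∀ s, X.structureMap.finrank s = m

/-- `i : X ⟶ Y` exhibits `X` as a closed flat subgroup scheme of `Y`. -/
structure IsClosedFlatSubgroup {X Y : CommGroupScheme O} (i : X ⟶ Y) : Prop where
  closed : IsClosedImmersion (schemeMap i)
  flat : Flat X.structureMap

/-- `0 ⟶ A ⟶ B ⟶ D ⟶ 0` is exact, for finite flat group schemes: `i` is a kernel of `q` and `q` is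
faithfully flat. In other words, `q` exhibits `D` as the quotient of `B` by `A`. -/
structure IsShortExact {A B D : CommGroupScheme O} (i : A ⟶ B) (q : B ⟶ D) : Prop where
  comp_eq_zero : i ≫ q = 0
  isKernel : Nonempty (IsLimit (KernelFork.ofι i comp_eq_zero))
  flat : Flat (schemeMap q)
  surjective : Surjective (schemeMap q)

/-- `X` has a filtration `0 = X₀ ⊆ X₁ ⊆ ⋯ ⊆ Xₘ = X` by closed flat subgroup schemes, all of whose
successive quotients satisfy `S`. The filtration is built from the bottom, each step being
`0 ⟶ Xₖ ⟶ Xₖ₊₁ ⟶ Q ⟶ 0` with `Q` in `S`. -/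
inductive HasFiltration (S : ObjectProperty (CommGroupScheme O)) : CommGroupScheme O → Prop
  | zero (X : CommGroupScheme O) (hX : IsZero X) : HasFiltration S X
  | step {A B Q : CommGroupScheme O} (i : A ⟶ B) (q : B ⟶ Q) (hA : HasFiltration S A)
      (hi : IsClosedFlatSubgroup i) (hB : IsFiniteFlat B) (h : IsShortExact i q) (hQ : S Q) :
      HasFiltration S B

/-! ### Extensions inside a full subcategory -/

/-- An extension `0 ⟶ B ⟶ E ⟶ A ⟶ 0` of `A` by `B` whose middle term lies in `𝒞`. -/
structure Extension (𝒞 : ObjectProperty (CommGroupScheme O)) (A B : CommGroupScheme O) where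
  mid : CommGroupScheme O
  mem : 𝒞 mid
  inc : B ⟶ mid
  proj : mid ⟶ A
  exact : IsShortExact inc proj

/-- Two extensions are equivalent if an isomorphism of the middle terms induces the identity on
the sub and on the quotient. -/
instance Extension.setoid (𝒞 : ObjectProperty (CommGroupScheme O)) (A B : CommGroupScheme O) :
    Setoid (Extension 𝒞 A B) where
  r E E' := ∃ φ : E.mid ≅ E'.mid, E.inc ≫ φ.hom = E'.inc ∧ φ.hom ≫ E'.proj = E.proj
  iseqv :=
    { refl := fun E => ⟨Iso.refl _, by simp, by simp⟩
      symm := by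
        rintro E E' ⟨φ, h₁, h₂⟩
        exact ⟨φ.symm, by simp [← h₁], by simp [← h₂]⟩
      trans := by
        rintro E E' E'' ⟨φ, h₁, h₂⟩ ⟨ψ, h₃, h₄⟩
        exact ⟨φ ≪≫ ψ, by simp [← h₃, ← h₁], by simp [← h₂, ← h₄]⟩ }

/-- `Ext_𝒞(A, B)`: equivalence classes of extensions of `A` by `B` whose middle term lies in `𝒞`.
Its zero element is the class of the split extension. -/
def ExtIn (𝒞 : ObjectProperty (CommGroupScheme O)) (A B : CommGroupScheme O) : Type (u + 1) :=
  Quotient (Extension.setoid 𝒞 A B)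

end CommGroupScheme

open CommGroupScheme

/-! ### `p`-divisible groups -/

/-- A `p`-divisible group over `O`: an inductive system of finite flat commutative group schemes
`Gₙ` of order `p ^ (n * h)` such that `Gₙ ⟶ Gₙ₊₁` is a kernel of multiplication by `p ^ n`. -/
structure PDivisibleGroup (p : ℕ) (O : Type u) [CommRing O] where
  height : ℕ
  level : ℕ → CommGroupScheme O
  isFiniteFlat (n : ℕ) : IsFiniteFlat (level n)
  hasOrder (n : ℕ) : HasOrder (level n) (p ^ (n * height))
  incl (n : ℕ) : level n ⟶ level (n + 1)
  incl_pow (n : ℕ) : incl n ≫ ((p ^ n : ℕ) • 𝟙 (level (n + 1))) = 0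
  isKernel (n : ℕ) : Nonempty (IsLimit (KernelFork.ofι (incl n) (incl_pow n)))

namespace PDivisibleGroup

variable {p : ℕ} {O : Type u} [CommRing O]

/-- A homomorphism of `p`-divisible groups: a homomorphism on each level, compatible with the
inclusions. -/
@[ext]
structure Hom (G H : PDivisibleGroup p O) where
  app (n : ℕ) : G.level n ⟶ H.level n
  comm (n : ℕ) : G.incl n ≫ app (n + 1) = app n ≫ H.incl n

instance category : Category (PDivisibleGroup p O) where
  Hom G H := Hom G H
  id G := ⟨fun _ => 𝟙 _, fun _ => by simp⟩
  comp f g := ⟨fun n => f.app n ≫ g.app n, fun n => by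
    rw [← Category.assoc, f.comm, Category.assoc, g.comm, Category.assoc]⟩
  id_comp f := Hom.ext (funext fun n => Category.id_comp (f.app n))
  comp_id f := Hom.ext (funext fun n => Category.comp_id (f.app n))
  assoc f g h := Hom.ext (funext fun n => Category.assoc (f.app n) (g.app n) (h.app n))

/-- The component of a homomorphism at level `n`. -/
def app {G H : PDivisibleGroup p O} (f : G ⟶ H) (n : ℕ) : G.level n ⟶ H.level n := Hom.app f n

variable {G H K : PDivisibleGroup p O}

@[ext]
theorem hom_ext {f g : G ⟶ H} (h : ∀ n, app f n = app g n) : f = g := Hom.ext (funext h)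

theorem incl_app (f : G ⟶ H) (n : ℕ) : G.incl n ≫ app f (n + 1) = app f n ≫ H.incl n :=
  Hom.comm f n

instance homAdd : Add (G ⟶ H) := ⟨fun f g => ⟨fun n => app f n + app g n, fun n => by
  simp [incl_app]⟩⟩

instance homZero : Zero (G ⟶ H) := ⟨⟨fun _ => 0, fun n => by simp⟩⟩

instance homNeg : Neg (G ⟶ H) := ⟨fun f => ⟨fun n => -app f n, fun n => by simp [incl_app]⟩⟩

@[simp] theorem id_app (n : ℕ) : app (𝟙 G) n = 𝟙 (G.level n) := rfl

@[simp] theorem comp_app (f : G ⟶ H) (g : H ⟶ K) (n : ℕ) :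
    app (f ≫ g) n = app f n ≫ app g n := rfl

@[simp] theorem add_app (f g : G ⟶ H) (n : ℕ) : app (f + g) n = app f n + app g n := rfl

@[simp] theorem zero_app (n : ℕ) : app (0 : G ⟶ H) n = 0 := rfl

@[simp] theorem neg_app (f : G ⟶ H) (n : ℕ) : app (-f) n = -app f n := rfl

/-- Homomorphisms of `p`-divisible groups are added levelwise. -/
instance homAddCommGroup : AddCommGroup (G ⟶ H) where
  nsmul := nsmulRec
  zsmul := zsmulRec
  add_assoc f g h := by ext n; simp [add_assoc]
  zero_add f := by ext n; simp
  add_zero f := by ext n; simp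
  neg_add_cancel f := by ext n; simp
  add_comm f g := by ext n; simp [add_comm]

/-- In particular `End G` is a ring, with composition as multiplication. -/
instance preadditive : Preadditive (PDivisibleGroup p O) where
  add_comp _ _ _ f g h := by ext n; simp
  comp_add _ _ _ f g h := by ext n; simp

/-- For an endomorphism `f` of `G`, the group scheme `G[fⁿ]`, realised as the kernel of `fⁿ` on
`Gₙ = G[pⁿ]`. This is all of the kernel of `fⁿ` on `G` as soon as `f` divides `p` in a commutative
subring of `End G`, as a uniformizer does when `End G` is a discrete valuation ring. -/
def torsion (G : PDivisibleGroup p O) (f : End G) (n : ℕ) : CommGroupScheme O :=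
  kernel (app (f ^ n : End G) n)

/-- The inclusion `G[fⁿ] ⟶ Gₙ`. -/
def torsionIncl (G : PDivisibleGroup p O) (f : End G) (n : ℕ) : G.torsion f n ⟶ G.level n :=
  kernel.ι (app (f ^ n : End G) n)

theorem torsionIncl_comp (G : PDivisibleGroup p O) (f : End G) (n : ℕ) :
    G.torsionIncl f n ≫ app (f ^ n : End G) n = 0 :=
  kernel.condition _

instance torsionIncl_mono (G : PDivisibleGroup p O) (f : End G) (n : ℕ) :
    Mono (G.torsionIncl f n) :=
  inferInstanceAs (Mono (kernel.ι (app (f ^ n : End G) n)))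

/-- The inclusion `G[fⁿ] ⟶ G[fⁿ⁺¹]`, induced by `Gₙ ⟶ Gₙ₊₁`. -/
def torsionSucc (G : PDivisibleGroup p O) (f : End G) (n : ℕ) :
    G.torsion f n ⟶ G.torsion f (n + 1) :=
  kernel.lift _ (G.torsionIncl f n ≫ G.incl n) (by
    rw [Category.assoc, incl_app, pow_succ', End.mul_def, comp_app, ← Category.assoc,
      ← Category.assoc, torsionIncl_comp, zero_comp, zero_comp])

section Residue

variable {R : Type w} [CommRing R] (e : R ≃+* End G) (ϖ : R)

theorem torsionAction_aux (n : ℕ) (r : R) :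
    app (e ϖ ^ n : End G) n ≫ app (e r) n = app (e r) n ≫ app (e ϖ ^ n : End G) n := by
  have h : e r * e ϖ ^ n = e ϖ ^ n * e r := by rw [← map_pow, ← map_mul, ← map_mul, mul_comm]
  exact congrArg (fun f : G ⟶ G => app f n) h

/-- When `End G` is identified with a commutative ring `R`, an element of `R` acts on `G[ϖⁿ]` by
restriction of the corresponding endomorphism of `G`. -/
def torsionMap (n : ℕ) (r : R) : G.torsion (e ϖ) n ⟶ G.torsion (e ϖ) n :=
  kernel.map _ _ (app (e r) n) (app (e r) n) (torsionAction_aux e ϖ n r)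

theorem torsionMap_incl (n : ℕ) (r : R) :
    torsionMap e ϖ n r ≫ G.torsionIncl (e ϖ) n = G.torsionIncl (e ϖ) n ≫ app (e r) n :=
  kernel.lift_ι _ _ _

/-- The action of `R` on `G[ϖⁿ]` as a ring homomorphism. -/
def torsionAction (n : ℕ) : R →+* End (G.torsion (e ϖ) n) where
  toFun r := torsionMap e ϖ n r
  map_one' := by
    rw [← cancel_mono (G.torsionIncl (e ϖ) n), torsionMap_incl, map_one]
    simp [End.one_def]
  map_mul' r s := by
    rw [← cancel_mono (G.torsionIncl (e ϖ) n), torsionMap_incl, map_mul, End.mul_def, End.mul_def,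
      Category.assoc, torsionMap_incl, ← Category.assoc, torsionMap_incl, comp_app, Category.assoc]
  map_zero' := by
    rw [← cancel_mono (G.torsionIncl (e ϖ) n), torsionMap_incl, map_zero, zero_app, comp_zero,
      zero_comp]
  map_add' r s := by
    rw [← cancel_mono (G.torsionIncl (e ϖ) n), torsionMap_incl, map_add, add_app,
      Preadditive.comp_add, Preadditive.add_comp, torsionMap_incl, torsionMap_incl]

/-- The action of the residue field `k = R / ϖ R` on `G[ϖ]`. -/
def residueAction : R ⧸ Ideal.span {ϖ} →+* End (G.torsion (e ϖ) 1) :=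
  Ideal.Quotient.lift _ (torsionAction e ϖ 1) (by
    intro a ha
    obtain ⟨b, rfl⟩ := Ideal.mem_span_singleton'.1 ha
    have h : torsionMap e ϖ 1 ϖ = 0 := by
      rw [← cancel_mono (G.torsionIncl (e ϖ) 1), torsionMap_incl, zero_comp]
      simpa using torsionIncl_comp G (e ϖ) 1
    rw [map_mul]
    have h' : torsionAction e ϖ 1 ϖ = 0 := h
    rw [h', mul_zero])

/-- The dimension of `Hom(G[ϖ], G[ϖ])` as a vector space over `k = R / ϖ R`, which acts through
its action on the target. -/
def homFinrank : ℕ :=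
  letI : Module (R ⧸ Ideal.span {ϖ}) (G.torsion (e ϖ) 1 ⟶ G.torsion (e ϖ) 1) :=
    Module.compHom _ (residueAction e ϖ)
  Module.finrank (R ⧸ Ideal.span {ϖ}) (G.torsion (e ϖ) 1 ⟶ G.torsion (e ϖ) 1)

end Residue

/-- The graph of the connecting map `δ : Hom(G[ϖ], G[ϖ]) ⟶ Ext_𝒞(G[ϖ], G[ϖ])` attached to the exact
sequence `0 ⟶ G[ϖ] ⟶ G[ϖ²] ⟶ G[ϖ] ⟶ 0` whose second map is multiplication by `ϖ`: the class `c` is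
`δ f` when it is the class of the pullback of that sequence along `f`, that is, of an extension `E`
with a commutative diagram

    0 ⟶ G[ϖ] ⟶  E   ⟶ G[ϖ] ⟶ 0
         ‖       |h       |f
    0 ⟶ G[ϖ] ⟶ G[ϖ²] ⟶ G[ϖ] ⟶ 0.

The right-hand square is written out after the inclusion of the lower right `G[ϖ]` into `G₂`. -/
def IsConnecting (G : PDivisibleGroup p O) (ϖ : End G) (𝒞 : ObjectProperty (CommGroupScheme O))
    (f : G.torsion ϖ 1 ⟶ G.torsion ϖ 1) (c : ExtIn 𝒞 (G.torsion ϖ 1) (G.torsion ϖ 1)) : Prop :=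
  ∃ (E : Extension 𝒞 (G.torsion ϖ 1) (G.torsion ϖ 1)) (h : E.mid ⟶ G.torsion ϖ 2),
    Quotient.mk _ E = c ∧ E.inc ≫ h = G.torsionSucc ϖ 1 ∧
      h ≫ G.torsionIncl ϖ 2 ≫ app ϖ 2 = E.proj ≫ f ≫ G.torsionIncl ϖ 1 ≫ G.incl 1

end PDivisibleGroup
end

open CommGroupScheme

/-! The proof is an induction along the filtration. Let `T i n` be the `ϖ i ^ n`-torsion of `G i`,
and let `0 → X' → X → T j 1 → 0` be exact with `X'` already a direct sum of terms `T i n`, the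
coordinates being `φ s : X' → T (a s) (n s)`. The aim is to extend the coordinates to `X`.

If `a s ≠ j`, then `φ s` extends, by dévissage from the vanishing of the mixed extension groups. If
`a s = j`, then `φ s` extends after enlarging its target by one step, because surjectivity of `δ`
makes every self-extension of `T j 1` a pullback of `T j 2`. So there is always `f s : X → T (a s)
(n s + 1)`, and its composite with the projection to `T (a s) 1` factors through an obstruction `g s
: T j 1 → T (a s) 1`, which can be nonzero only for `a s = j` (`exists_obstruction`).

If every `g s` vanishes, all coordinates extend, the sequence splits and `X ≅ T j 1 ⊕ X'`. Otherwise
take `s₀` with `g s₀ ≠ 0` and `n s₀` maximal. Since `Hom(T j 1, T j 1)` is a line over the residue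
field, `g s₀` is invertible and every other obstruction is a multiple of it by a scalar that lifts
to `R j`, hence acts on the whole tower. Subtracting multiples of `φ s₀` makes the other coordinates
extend (`exists_correction`). Together with `f s₀` they map `X` to `T j (n s₀ + 1)` plus the
remaining summands, inducing isomorphisms on sub and quotient; the five lemma finishes
(`isSumOfTowers_of_isShortExact`).

Two geometric facts support this. First, quotients needed for the dévissage are built by hand: if `E
→ S` is a quotient by `A` and `P → E` is faithfully flat with a compatible copy of `A` in `P`, then
`P / A` is obtained by flat descent along `E → S` (`IsShortExact.exists_descent`). Second,
multiplication by `ϖ` from `T i (n + 1)` to `T i n` must be faithfully flat. For a homomorphism with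
finite flat kernel of constant order the self-fibre product is the source times the kernel, so
faithful flatness reduces to injectivity on coordinate rings (`isShortExact_of_injective`). For
multiplication by `p` a count of orders gives injectivity; for `ϖ` it follows because `ϖ` divides
`p`. -/

open scoped TensorProduct

/-! ### Flatness and rank of `M` over `C`, read off from `M ⊗[C] M` -/

/-- Over a local ring `C`, a finite injective algebra `M` such that `M ⊗[C] M` is flat of constant
rank over `M` is free. -/
theorem Module.Flat.of_tensor_self_of_isLocalRing {C M : Type*} [CommRing C] [CommRing M]
    [Algebra C M] [IsLocalRing C] [Module.Finite C M]
    (hinj : Function.Injective (algebraMap C M)) [Module.Flat M (M ⊗[C] M)] (d : ℕ)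
    (hd : ∀ P, Module.rankAtStalk (R := M) (M ⊗[C] M) P = d) : Module.Flat C M := by
  let k := IsLocalRing.ResidueField C
  have : FaithfulSMul C M := (faithfulSMul_iff_algebraMap_injective C M).2 hinj
  let b := Module.finBasis k (k ⊗[C] M)
  obtain ⟨f, hf⟩ : ∃ f : Fin (Module.finrank k (k ⊗[C] M)) → M, ∀ i, (1 : k) ⊗ₜ[C] f i = b i := by
    have hs : Function.Surjective (TensorProduct.mk C k M 1) :=
      TensorProduct.mk_surjective C M k IsLocalRing.residue_surjective
    choose f hf using fun i => hs (b i)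
    exact ⟨f, hf⟩
  have hspan := IsLocalRing.span_eq_top_of_tmul_eq_basis f b hf
  -- A prime of `M` above the closed point: the fibre of `M ⊗[C] M` there is a base change of `k
  -- ⊗[C] M`, so the size of a minimal generating set of `M` is `d`.
  obtain ⟨P, hP⟩ := Algebra.IsIntegral.comap_surjective C M (IsLocalRing.closedPoint C)
  have hn : Module.finrank k (k ⊗[C] M) = d := by
    rw [← hd P, Module.rankAtStalk_eq]
    let K := P.asIdeal.ResidueField
    have : IsLocalHom (algebraMap C K) := ⟨fun a ha => by
      by_contra h
      have h1 : a ∈ (PrimeSpectrum.comap (algebraMap C M) P).asIdeal := by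
        rw [hP]; exact (IsLocalRing.mem_maximalIdeal a).2 h
      have h2 : algebraMap C K a = 0 := by
        rw [IsScalarTower.algebraMap_apply C M K]
        exact Ideal.algebraMap_residueField_eq_zero.2 h1
      rw [h2] at ha
      exact not_isUnit_zero ha⟩
    let : Algebra k K := (IsLocalRing.ResidueField.lift (algebraMap C K)).toAlgebra
    have : IsScalarTower C k K := IsScalarTower.of_algebraMap_eq fun a => by
      exact (IsLocalRing.ResidueField.lift_residue_apply (algebraMap C K) a).symm
    have e1 : K ⊗[M] (M ⊗[C] M) ≃ₗ[K] K ⊗[C] M :=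
      TensorProduct.AlgebraTensorModule.cancelBaseChange C M K K M
    have e2 : K ⊗[k] (k ⊗[C] M) ≃ₗ[K] K ⊗[C] M :=
      TensorProduct.AlgebraTensorModule.cancelBaseChange C k K K M
    exact (Module.finrank_baseChange (R := K) (S := k) (M' := k ⊗[C] M)).symm.trans
      (e2.finrank_eq.trans e1.finrank_eq.symm)
  let g : (Fin (Module.finrank k (k ⊗[C] M)) → C) →ₗ[C] M := Fintype.linearCombination C f
  have hg : Function.Surjective g := by
    rw [← LinearMap.range_eq_top, Fintype.range_linearCombination, hspan]
  -- The presentation `g` by minimal generators becomes, over `M`, a surjection between modules of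
  -- the same rank, hence bijective; injectivity then comes back to `C` because `C → M` is
  -- injective.
  have hgM : Function.Bijective (g.baseChange M) := by
    have hs : Function.Surjective (g.baseChange M) := LinearMap.lTensor_surjective M hg
    refine Module.bijective_of_surjective_of_rankAtStalk_eq hs fun m hm => ?_
    have : Nontrivial M := ⟨⟨0, 1, fun h => zero_ne_one (hinj (by simpa using h))⟩⟩
    rw [hd, Module.rankAtStalk_eq_finrank_of_free]
    simp [hn]
  have hi : Function.Injective g := by
    have h1 : Function.Injective ((Algebra.linearMap C M).rTensor
        (Fin (Module.finrank k (k ⊗[C] M)) → C)) :=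
      Module.Flat.rTensor_preserves_injective_linearMap _ hinj
    have h2 : Function.Injective fun x : Fin (Module.finrank k (k ⊗[C] M)) → C =>
        (1 : M) ⊗ₜ[C] x := by
      intro x y hxy
      have := @h1 (1 ⊗ₜ x) (1 ⊗ₜ y) (by simpa using hxy)
      simpa using congrArg (TensorProduct.lid C _) this
    intro x y hxy
    apply h2
    apply hgM.1
    simp [hxy]
  exact Module.Flat.of_linearEquiv (LinearEquiv.ofBijective g ⟨hi, hg⟩).symm

theorem Module.Flat.of_tensor_self_of_isLocalization {C M L : Type*} [CommRing C] [CommRing M]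
    [Algebra C M] [Module.Finite C M] [CommRing L] [Algebra C L] [IsLocalRing L] [Module.Flat C L]
    (hinj : Function.Injective (algebraMap C M)) [Module.Flat M (M ⊗[C] M)] (d : ℕ)
    (hd : ∀ P, Module.rankAtStalk (R := M) (M ⊗[C] M) P = d) : Module.Flat L (L ⊗[C] M) := by
  let : Algebra M (L ⊗[C] M) := Algebra.TensorProduct.rightAlgebra
  have : IsScalarTower C M (L ⊗[C] M) := Algebra.TensorProduct.right_isScalarTower
  have e1 : (L ⊗[C] M) ⊗[M] (M ⊗[C] M) ≃ₗ[L ⊗[C] M] (L ⊗[C] M) ⊗[C] M :=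
    TensorProduct.AlgebraTensorModule.cancelBaseChange C M (L ⊗[C] M) (L ⊗[C] M) M
  have e2 : (L ⊗[C] M) ⊗[L] (L ⊗[C] M) ≃ₗ[L ⊗[C] M] (L ⊗[C] M) ⊗[C] M :=
    TensorProduct.AlgebraTensorModule.cancelBaseChange C L (L ⊗[C] M) (L ⊗[C] M) M
  have e := e1.trans e2.symm
  have : Module.Flat (L ⊗[C] M) ((L ⊗[C] M) ⊗[L] (L ⊗[C] M)) := Module.Flat.of_linearEquiv e.symm
  refine Module.Flat.of_tensor_self_of_isLocalRing ?_ d fun Q => ?_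
  · have := Module.Flat.lTensor_preserves_injective_linearMap (M := L) (Algebra.linearMap C M) hinj
    intro x y hxy
    have h := @this (x ⊗ₜ 1) (y ⊗ₜ 1) (by simpa using hxy)
    simpa using congrArg (TensorProduct.rid C _) h
  · rw [← Module.rankAtStalk_eq_of_equiv e, Module.rankAtStalk_baseChange, hd]

theorem Module.Flat.of_tensor_self {C M : Type*} [CommRing C] [CommRing M]
    [Algebra C M] [Module.Finite C M]
    (hinj : Function.Injective (algebraMap C M)) [Module.Flat M (M ⊗[C] M)] (d : ℕ)
    (hd : ∀ P, Module.rankAtStalk (R := M) (M ⊗[C] M) P = d) : Module.Flat C M := by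
  refine Module.flat_of_isLocalized_maximal C M (fun P _ => Localization.AtPrime P ⊗[C] M)
    (fun P _ => TensorProduct.mk C (Localization.AtPrime P) M 1) fun P _ => ?_
  rw [← Module.flat_iff_of_isLocalization (Localization.AtPrime P) P.primeCompl]
  have : Module.Flat C (Localization.AtPrime P) := IsLocalization.flat _ P.primeCompl
  exact Module.Flat.of_tensor_self_of_isLocalization hinj d hd

theorem Module.rankAtStalk_of_tensor_self {C M : Type*} [CommRing C] [CommRing M]
    [Algebra C M] [Module.Finite C M] [Module.Flat C M]
    (hinj : Function.Injective (algebraMap C M)) (d : ℕ)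
    (hd : ∀ P, Module.rankAtStalk (R := M) (M ⊗[C] M) P = d) (p : PrimeSpectrum C) :
    Module.rankAtStalk M p = d := by
  have : FaithfulSMul C M := (faithfulSMul_iff_algebraMap_injective C M).2 hinj
  obtain ⟨P, rfl⟩ := Algebra.IsIntegral.comap_surjective C M p
  rw [← hd P, Module.rankAtStalk_baseChange]

theorem Module.finrank_fractionRing_tensor (O : Type*) [CommRing O] [IsDomain O] (N : Type*)
    [AddCommGroup N] [Module O N] :
    Module.finrank (FractionRing O) (FractionRing O ⊗[O] N) = Module.finrank O N := by
  rw [← IsLocalizedModule.finrank_eq (nonZeroDivisors O)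
    (TensorProduct.mk O (FractionRing O) N 1) le_rfl]
  exact IsLocalization.finrank_eq _ (nonZeroDivisors O) le_rfl

/-- Degrees multiply in a tower `O → C → M`. -/
theorem Module.finrank_eq_mul_of_rankAtStalk {O C M : Type*} [CommRing O] [IsDomain O] [CommRing C]
    [Algebra O C] [Module.Finite O C] [AddCommGroup M] [Module O M] [Module C M]
    [IsScalarTower O C M] [Module.Finite C M] [Module.Flat C M] (d : ℕ)
    (hd : ∀ p, Module.rankAtStalk (R := C) M p = d) :
    Module.finrank O M = d * Module.finrank O C := by
  let K := FractionRing O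
  let C' := K ⊗[O] C
  let : Algebra C C' := Algebra.TensorProduct.rightAlgebra
  have : IsScalarTower O C C' := Algebra.TensorProduct.right_isScalarTower
  have : IsArtinianRing C' := IsArtinianRing.of_finite K C'
  -- Over the fraction field the algebra is Artinian, hence semilocal, so a finite flat module of
  -- constant rank is free and degrees can be counted with a basis.
  obtain ⟨b⟩ := Module.nonempty_basis_of_flat_of_finrank_eq C' (C' ⊗[C] M) d fun P => by
    let := Ideal.Quotient.field P.asIdeal
    let Q : PrimeSpectrum (C' ⧸ P.asIdeal) := ⟨⊥, Ideal.isPrime_bot⟩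
    have h := Module.rankAtStalk_baseChange (R := C') (M := C' ⊗[C] M) Q
    rw [Module.rankAtStalk_baseChange, hd] at h
    rw [← h, Module.rankAtStalk_eq_finrank_of_free]
    rfl
  have e : C' ⊗[C] M ≃ₗ[K] K ⊗[O] M :=
    (Algebra.IsPushout.cancelBaseChange O K C C' M)
  have : Module.Free C' (C' ⊗[C] M) := Module.Free.of_basis b
  rw [← Module.finrank_fractionRing_tensor O M, ← Module.finrank_fractionRing_tensor O C,
    ← e.finrank_eq, (b.equivFun.restrictScalars K).finrank_eq, Module.finrank_pi_fintype]
  simp [C', K]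

/-- Let `C → M` be a homomorphism of finite torsion-free algebras over a domain `O`, with
`M ⊗[C] M` flat of constant rank `d` over `M` and `[M : O] = d * [C : O]`. Then `C → M` is
injective. -/
theorem Module.algebraMap_injective_of_tensor_self {O C M : Type*} [CommRing O] [IsDomain O]
    [IsNoetherianRing O] [CommRing C] [CommRing M] [Algebra O C] [Algebra O M] [Algebra C M]
    [IsScalarTower O C M]
    [Module.Finite O C] [Module.Finite O M] [Module.IsTorsionFree O C]
    [Module.Flat M (M ⊗[C] M)] (d : ℕ) (hd0 : d ≠ 0)
    (hd : ∀ P, Module.rankAtStalk (R := M) (M ⊗[C] M) P = d)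
    (hrank : Module.finrank O M = d * Module.finrank O C) :
    Function.Injective (algebraMap C M) := by
  -- Replacing `C` by its image `D` in `M` does not change `M ⊗ M`, so `M` is flat of rank `d` over
  -- `D`. Comparing degrees gives `[D : O] = [C : O]`; the kernel of `C → D` then has rank zero, and
  -- it is torsion inside a torsion-free module.
  let f := IsScalarTower.toAlgHom O C M
  let D := f.range
  have : Module.Finite O D := Module.Finite.of_surjective f.rangeRestrict.toLinearMap
    f.rangeRestrict_surjective
  have : Module.Finite D M := Module.Finite.of_restrictScalars_finite O D M
  let : Algebra C D := f.rangeRestrict.toRingHom.toAlgebra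
  have hCD : Function.Surjective (algebraMap C D) := f.rangeRestrict_surjective
  have : IsScalarTower C D M := IsScalarTower.of_algebraMap_eq fun x => rfl
  have : TensorProduct.CompatibleSMul D C M M := TensorProduct.CompatibleSMul.isScalarTower
  have : TensorProduct.CompatibleSMul C D M M := ⟨fun x m n => by
    obtain ⟨x, rfl⟩ := hCD x
    rw [algebraMap_smul, algebraMap_smul, TensorProduct.smul_tmul]⟩
  let e : M ⊗[C] M ≃ₗ[M] M ⊗[D] M :=
    (Algebra.TensorProduct.equivOfCompatibleSMul D C M M M).toLinearEquiv
  have : Module.Flat M (M ⊗[D] M) := Module.Flat.of_linearEquiv e.symm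
  have hd' (P) : Module.rankAtStalk (R := M) (M ⊗[D] M) P = d := by
    rw [← Module.rankAtStalk_eq_of_equiv e, hd]
  have hinj : Function.Injective (algebraMap D M) := Subtype.val_injective
  have := Module.Flat.of_tensor_self hinj d hd'
  have h := Module.finrank_eq_mul_of_rankAtStalk (O := O) d
    (Module.rankAtStalk_of_tensor_self hinj d hd')
  have hCD : Module.finrank O C = Module.finrank O D :=
    Nat.eq_of_mul_eq_mul_left (Nat.pos_of_ne_zero hd0) (hrank.symm.trans h)
  have hker := Submodule.finrank_quotient_add_finrank (LinearMap.ker f.rangeRestrict.toLinearMap)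
  rw [(f.rangeRestrict.toLinearMap.quotKerEquivOfSurjective
    f.rangeRestrict_surjective).finrank_eq, ← hCD, Nat.add_eq_left,
    Module.finrank_eq_zero_iff_isTorsion] at hker
  rw [injective_iff_map_eq_zero]
  intro x hx
  have hx' : x ∈ LinearMap.ker f.rangeRestrict.toLinearMap := Subtype.ext hx
  obtain ⟨a, ha⟩ := @hker ⟨x, hx'⟩
  have ha' : (a : O) • x = 0 := congrArg Subtype.val ha
  exact (smul_eq_zero.1 ha').resolve_left (nonZeroDivisors.ne_zero a.2)

/-! ### Flat descent of affine schemes from a split fork -/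

/-- Flatness of `M` identifies `M ⊗ eq(f, g)` with the equalizer of the base-changed pair. The maps
`e` and `t` split that pair, with `N` as its equalizer, so the two equalizers agree. Thus `eq(f, g)`
is a descent of `N` from `M` to `B`. -/
theorem AlgHom.bijective_productMap_equalizer {B M N W : Type*} [CommRing B] [CommRing M]
    [CommRing N] [CommRing W] [Algebra B M] [Algebra B N] [Algebra B W] [Module.Flat B M]
    (α : M →ₐ[B] N) (f g : N →ₐ[B] W) (e : N →+* M ⊗[B] N) (t : M ⊗[B] W →+* M ⊗[B] N)
    (he : ∀ n, Algebra.TensorProduct.map (AlgHom.id B M) f (e n) =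
      Algebra.TensorProduct.map (AlgHom.id B M) g (e n))
    (hs : ∀ n, Algebra.TensorProduct.productMap α (AlgHom.id B N) (e n) = n)
    (hf : ∀ x, t (Algebra.TensorProduct.map (AlgHom.id B M) f x) =
      e (Algebra.TensorProduct.productMap α (AlgHom.id B N) x))
    (hg : ∀ x, t (Algebra.TensorProduct.map (AlgHom.id B M) g x) = x) :
    Function.Bijective (Algebra.TensorProduct.productMap α (AlgHom.equalizer f g).val) := by
  have key : ∀ x : M ⊗[B] AlgHom.equalizer f g,
      Algebra.TensorProduct.productMap α (AlgHom.equalizer f g).val x =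
      Algebra.TensorProduct.productMap α (AlgHom.id B N)
        (Algebra.TensorProduct.map (AlgHom.id B M) (AlgHom.equalizer f g).val x) := by
    intro x
    rw [← AlgHom.comp_apply]
    congr 1
    ext <;> simp
  have hinj : Function.Injective
      (Algebra.TensorProduct.map (AlgHom.id B M) (AlgHom.equalizer f g).val) :=
    Module.Flat.lTensor_preserves_injective_linearMap (M := M)
      (AlgHom.equalizer f g).val.toLinearMap Subtype.val_injective
  have heq : (Algebra.TensorProduct.map (AlgHom.id B M) f).comp
        (Algebra.TensorProduct.map (AlgHom.id B M) (AlgHom.equalizer f g).val) =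
      (Algebra.TensorProduct.map (AlgHom.id B M) g).comp
        (Algebra.TensorProduct.map (AlgHom.id B M) (AlgHom.equalizer f g).val) := by
    ext x
    · simp
    · simpa using congrArg (fun y => (1 : M) ⊗ₜ[B] y) x.2
  constructor
  · rw [injective_iff_map_eq_zero]
    intro x hx
    rw [key] at hx
    apply hinj
    have h := hg (Algebra.TensorProduct.map (AlgHom.id B M) (AlgHom.equalizer f g).val x)
    rw [← AlgHom.comp_apply, ← heq, AlgHom.comp_apply, hf, hx, map_zero] at h
    rw [← h, map_zero]
  · intro n
    obtain ⟨x, hx⟩ := (AlgHom.tensorEqualizerEquiv B M f g).surjective ⟨e n, he n⟩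
    have hx' : Algebra.TensorProduct.map (AlgHom.id B M) (AlgHom.equalizer f g).val x = e n :=
      (AlgHom.coe_tensorEqualizer B M f g x).symm.trans (congrArg Subtype.val hx)
    exact ⟨x, by rw [key, hx', hs]⟩

/-- This transports the preceding computation from tensor products to arbitrary pushout squares, the
form in which it dualizes to schemes. -/
theorem CommRingCat.exists_isPushout_of_split {B M N W MN MW : CommRingCat.{u}} {φ : B ⟶ M}
    (hφ : φ.hom.Flat) {β : B ⟶ N} {α : M ⟶ N} (hα : φ ≫ α = β) {f g : N ⟶ W}
    (hfg : β ≫ f = β ≫ g) {jM : M ⟶ MN} {jN : N ⟶ MN} (hMN : IsPushout φ β jM jN)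
    {kM : M ⟶ MW} {kW : W ⟶ MW} (hMW : IsPushout φ (β ≫ f) kM kW)
    {mf mg : MN ⟶ MW} (hMf : jM ≫ mf = kM) (hNf : jN ≫ mf = f ≫ kW)
    (hMg : jM ≫ mg = kM) (hNg : jN ≫ mg = g ≫ kW)
    {s : MN ⟶ N} (hMs : jM ≫ s = α) (hNs : jN ≫ s = 𝟙 N) {e : N ⟶ MN} (he : e ≫ mf = e ≫ mg)
    (hes : e ≫ s = 𝟙 N) {t : MW ⟶ MN} (hft : mf ≫ t = s ≫ e) (hgt : mg ≫ t = 𝟙 MN) :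
    ∃ (N' : CommRingCat.{u}) (i : N' ⟶ N) (β' : B ⟶ N'),
      β' ≫ i = β ∧ i ≫ f = i ≫ g ∧ IsPushout φ β' α i := by
  let : Algebra B M := φ.hom.toAlgebra
  let : Algebra B N := β.hom.toAlgebra
  let : Algebra B W := (β ≫ f).hom.toAlgebra
  have : Module.Flat B M := hφ
  let α' : M →ₐ[B] N := { α.hom with commutes' := fun b => congr($(hα).hom b) }
  let f' : N →ₐ[B] W := { f.hom with commutes' := fun b => rfl }
  let g' : N →ₐ[B] W := { g.hom with commutes' := fun b => congr($(hfg.symm).hom b) }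
  have h1 : IsPushout φ β (CommRingCat.ofHom (algebraMap M (TensorProduct B M N)))
      (CommRingCat.ofHom
        (Algebra.TensorProduct.includeRight (R := B) (A := M) (B := N)).toRingHom) :=
    CommRingCat.isPushout_tensorProduct B M N
  have h2 : IsPushout φ (β ≫ f) (CommRingCat.ofHom (algebraMap M (TensorProduct B M W)))
      (CommRingCat.ofHom
        (Algebra.TensorProduct.includeRight (R := B) (A := M) (B := W)).toRingHom) :=
    CommRingCat.isPushout_tensorProduct B M W
  let a : MN ≅ CommRingCat.of (TensorProduct B M N) := hMN.isoIsPushout _ _ h1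
  let b : MW ≅ CommRingCat.of (TensorProduct B M W) := hMW.isoIsPushout _ _ h2
  have hmf : a.inv ≫ mf ≫ b.hom =
      CommRingCat.ofHom (Algebra.TensorProduct.map (AlgHom.id B M) f').toRingHom := by
    apply h1.hom_ext
    · rw [hMN.inl_isoIsPushout_inv_assoc, reassoc_of% hMf, hMW.inl_isoIsPushout_hom]
      ext x
      simp
    · rw [hMN.inr_isoIsPushout_inv_assoc, reassoc_of% hNf, hMW.inr_isoIsPushout_hom]
      ext x
      simp [f']
  have hmg : a.inv ≫ mg ≫ b.hom =
      CommRingCat.ofHom (Algebra.TensorProduct.map (AlgHom.id B M) g').toRingHom := by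
    apply h1.hom_ext
    · rw [hMN.inl_isoIsPushout_inv_assoc, reassoc_of% hMg, hMW.inl_isoIsPushout_hom]
      ext x
      simp
    · rw [hMN.inr_isoIsPushout_inv_assoc, reassoc_of% hNg, hMW.inr_isoIsPushout_hom]
      ext x
      simp [g']
  have hss : a.inv ≫ s =
      CommRingCat.ofHom (Algebra.TensorProduct.productMap α' (AlgHom.id B N)).toRingHom := by
    apply h1.hom_ext
    · rw [hMN.inl_isoIsPushout_inv_assoc, hMs]
      ext x
      simp [α']
    · rw [hMN.inr_isoIsPushout_inv_assoc, hNs]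
      ext x
      simp
  have hbij := AlgHom.bijective_productMap_equalizer α' f' g' (e ≫ a.hom).hom
    (b.inv ≫ t ≫ a.hom).hom
    (fun n => by
      have : (e ≫ a.hom) ≫ a.inv ≫ mf ≫ b.hom = (e ≫ a.hom) ≫ a.inv ≫ mg ≫ b.hom := by
        simp [reassoc_of% he]
      rw [hmf, hmg] at this
      exact congr($(this).hom n))
    (fun n => by
      have : (e ≫ a.hom) ≫ a.inv ≫ s = 𝟙 N := by simp [hes]
      rw [hss] at this
      exact congr($(this).hom n))
    (fun x => by
      have : (a.inv ≫ mf ≫ b.hom) ≫ b.inv ≫ t ≫ a.hom = (a.inv ≫ s) ≫ e ≫ a.hom := by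
        simp [reassoc_of% hft]
      rw [hmf, hss] at this
      exact congr($(this).hom x))
    (fun x => by
      have : (a.inv ≫ mg ≫ b.hom) ≫ b.inv ≫ t ≫ a.hom = 𝟙 _ := by
        simp [reassoc_of% hgt]
      rw [hmg] at this
      exact congr($(this).hom x))
  refine ⟨CommRingCat.of (AlgHom.equalizer f' g'),
    CommRingCat.ofHom (AlgHom.equalizer f' g').val.toRingHom,
    CommRingCat.ofHom (algebraMap B (AlgHom.equalizer f' g')), rfl, ?_, ?_⟩
  · ext x
    exact x.2
  · let c : TensorProduct B M (AlgHom.equalizer f' g') ≃+* N :=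
      RingEquiv.ofBijective (Algebra.TensorProduct.productMap α' (AlgHom.equalizer f' g').val) hbij
    refine (CommRingCat.isPushout_tensorProduct B M (AlgHom.equalizer f' g')).of_iso (Iso.refl _)
      (Iso.refl _) (Iso.refl _) c.toCommRingCatIso ?_ ?_ ?_ ?_
    · rfl
    · rfl
    · ext x
      simp [c, α']
    · ext x
      simp [c]

namespace AlgebraicGeometry

/-- Descent of an affine scheme along a faithfully flat morphism `π : E ⟶ S` of affine schemes:
if the pair `f, g : W ⟶ P` over `S` becomes part of a split coequalizer `EW ⟶ EP ⟶ P` after base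
change along `π`, then `P ⟶ E` is the base change of some affine `P' ⟶ S`. -/
theorem Scheme.exists_isPullback_of_split {S E P W EP EW : Scheme.{u}} [IsAffine S] [IsAffine E]
    [IsAffine P] [IsAffine W] {π : E ⟶ S} [Flat π] {ρ : P ⟶ E} {f g : W ⟶ P}
    (hfg : f ≫ ρ ≫ π = g ≫ ρ ≫ π) {x₁ : EP ⟶ E} {x₂ : EP ⟶ P}
    (hEP : IsPullback x₁ x₂ π (ρ ≫ π)) {w₁ : EW ⟶ E} {w₂ : EW ⟶ W}
    (hEW : IsPullback w₁ w₂ π (f ≫ ρ ≫ π)) {ef eg : EW ⟶ EP}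
    (hf₁ : ef ≫ x₁ = w₁) (hf₂ : ef ≫ x₂ = w₂ ≫ f)
    (hg₁ : eg ≫ x₁ = w₁) (hg₂ : eg ≫ x₂ = w₂ ≫ g)
    {s : P ⟶ EP} (hs₁ : s ≫ x₁ = ρ) (hs₂ : s ≫ x₂ = 𝟙 P)
    {y : EP ⟶ P} (hy : ef ≫ y = eg ≫ y) (hsy : s ≫ y = 𝟙 P)
    {t : EP ⟶ EW} (htf : t ≫ ef = y ≫ s) (htg : t ≫ eg = 𝟙 EP) :
    ∃ (P' : Scheme.{u}) (p : P ⟶ P') (s' : P' ⟶ S), IsAffine P' ∧ f ≫ p = g ≫ p ∧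
      IsPullback ρ p π s' := by
  have : IsAffine EP := .of_isIso hEP.isoPullback.hom
  have : IsAffine EW := .of_isIso hEW.isoPullback.hom
  have hF {X Y Z : Scheme.{u}} (a : X ⟶ Y) (b : Y ⟶ Z) (c : X ⟶ Z) (h : a ≫ b = c) :
      b.appTop ≫ a.appTop = c.appTop := by rw [← h, Scheme.Hom.comp_appTop]
  have hsq {X Y Y' Z : Scheme.{u}} (a : X ⟶ Y) (b : Y ⟶ Z) (c : X ⟶ Y') (d : Y' ⟶ Z)
      (h : a ≫ b = c ≫ d) : b.appTop ≫ a.appTop = d.appTop ≫ c.appTop := by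
    rw [← Scheme.Hom.comp_appTop, h, Scheme.Hom.comp_appTop]
  have hid {X Y : Scheme.{u}} (a : X ⟶ Y) (b : Y ⟶ X) (h : a ≫ b = 𝟙 X) :
      b.appTop ≫ a.appTop = 𝟙 _ := by rw [← Scheme.Hom.comp_appTop, h, Scheme.Hom.id_appTop]
  have h1 := isPushout_appTop_of_isPullback hEP
  have h2 := isPushout_appTop_of_isPullback hEW
  rw [Scheme.Hom.comp_appTop f] at h2
  obtain ⟨N', i, β', hβ, hi, hN⟩ := CommRingCat.exists_isPushout_of_split (φ := π.appTop)
    (Scheme.Hom.flat_appTop π) (hF ρ π _ rfl) (f := f.appTop) (g := g.appTop)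
    (by rw [← Scheme.Hom.comp_appTop, hfg, Scheme.Hom.comp_appTop]) h1 h2
    (hF _ _ _ hf₁) (hsq _ _ _ _ hf₂) (hF _ _ _ hg₁) (hsq _ _ _ _ hg₂) (hF _ _ _ hs₁) (hid _ _ hs₂)
    (hsq _ _ _ _ hy) (hid _ _ hsy) (hsq _ _ _ _ htf) (hid _ _ htg)
  refine ⟨Spec N', P.isoSpec.hom ≫ Spec.map i, Spec.map β' ≫ S.isoSpec.inv, inferInstance, ?_, ?_⟩
  · rw [← Scheme.isoSpec_hom_naturality_assoc, ← Scheme.isoSpec_hom_naturality_assoc,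
      ← Spec.map_comp,
      ← Spec.map_comp, hi]
  · have h := (hN.op.map Scheme.Spec).flip
    refine h.of_iso P.isoSpec.symm E.isoSpec.symm (Iso.refl _) S.isoSpec.symm ?_ ?_ ?_ ?_
    · exact Scheme.isoSpec_inv_naturality _
    · simp
    · exact Scheme.isoSpec_inv_naturality _
    · simp

/-! ### Faithful flatness of a finite morphism from its self-fibre product -/

theorem flat_tensor_of_isPullback {A B Z : Scheme.{u}} [IsAffine A] [IsAffine B] {f : A ⟶ B}
    {q₁ q₂ : Z ⟶ A} (h : IsPullback q₁ q₂ f f) [Flat q₁] [IsFinite q₁] {d : ℕ}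
    (hd : ∀ a, q₁.finrank a = d) :
    letI := f.appTop.hom.toAlgebra
    Module.Flat Γ(A, ⊤) (Γ(A, ⊤) ⊗[Γ(B, ⊤)] Γ(A, ⊤)) ∧
      ∀ P, Module.rankAtStalk (R := Γ(A, ⊤)) (Γ(A, ⊤) ⊗[Γ(B, ⊤)] Γ(A, ⊤)) P = d := by
  let := f.appTop.hom.toAlgebra
  have : IsAffine Z := .of_isIso h.isoPullback.hom
  have h1 := isPushout_appTop_of_isPullback h
  have h2 := CommRingCat.isPushout_tensorProduct Γ(B, ⊤) Γ(A, ⊤) Γ(A, ⊤)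
  let c := h1.isoIsPushout _ _ h2
  let φ := CommRingCat.ofHom (algebraMap Γ(A, ⊤) (Γ(A, ⊤) ⊗[Γ(B, ⊤)] Γ(A, ⊤)))
  have hc : q₁.appTop ≫ c.hom = φ := IsPushout.inl_isoIsPushout_hom _ _ h1 h2
  have hφ : Spec.map φ = (Spec.map c.hom ≫ Z.isoSpec.inv) ≫ q₁ ≫ A.isoSpec.hom := by
    rw [← Scheme.isoSpec_hom_naturality, ← hc, Spec.map_comp]
    simp
  have hflat : Flat (Spec.map φ) := by rw [hφ]; infer_instance
  have hfin : IsFinite (Spec.map φ) := by rw [hφ]; infer_instance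
  rw [Flat.SpecMap_iff] at hflat
  have hflat' : Module.Flat Γ(A, ⊤) (Γ(A, ⊤) ⊗[Γ(B, ⊤)] Γ(A, ⊤)) := by
    rw [← RingHom.flat_algebraMap_iff]; exact hflat
  have hfin' : Module.Finite Γ(A, ⊤) (Γ(A, ⊤) ⊗[Γ(B, ⊤)] Γ(A, ⊤)) := by
    rw [← RingHom.finite_algebraMap]; exact (IsFinite.SpecMap_iff _).1 hfin
  refine ⟨hflat', fun P => ?_⟩
  have h3 := Scheme.Hom.finrank_SpecMap_algebraMap Γ(A, ⊤) (Γ(A, ⊤) ⊗[Γ(B, ⊤)] Γ(A, ⊤)) P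
  have h4 : IsPullback (𝟙 Z) q₁ (q₁ ≫ A.isoSpec.hom) A.isoSpec.hom :=
    IsPullback.of_horiz_isIso ⟨by simp⟩
  rw [← h3]
  change (Spec.map φ).finrank P = d
  rw [hφ, Scheme.Hom.finrank_comp_left_of_isIso, ← hd (A.isoSpec.inv P),
    Scheme.Hom.finrank_of_isPullback _ _ _ _ h4]
  congr 1
  exact congr($(A.isoSpec.inv_hom_id) P).symm

theorem flat_and_surjective_of_isPullback {A B Z : Scheme.{u}} [IsAffine A] [IsAffine B] {f : A ⟶ B}
    [IsFinite f] {q₁ q₂ : Z ⟶ A} (h : IsPullback q₁ q₂ f f) [Flat q₁] [IsFinite q₁] {d : ℕ}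
    (hd : ∀ a, q₁.finrank a = d) (hinj : Function.Injective f.appTop.hom) :
    Flat f ∧ Surjective f := by
  let := f.appTop.hom.toAlgebra
  obtain ⟨h1, h2⟩ := flat_tensor_of_isPullback h hd
  have hfin : f.appTop.hom.Finite := Scheme.Hom.finite_appTop f
  have : Module.Finite Γ(B, ⊤) Γ(A, ⊤) := hfin
  have hflat : Module.Flat Γ(B, ⊤) Γ(A, ⊤) := Module.Flat.of_tensor_self hinj d h2
  rw [Flat.flat_and_surjective_iff_faithfullyFlat_of_isAffine,
    RingHom.FaithfullyFlat.iff_flat_and_comap_surjective]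
  have : FaithfulSMul Γ(B, ⊤) Γ(A, ⊤) := (faithfulSMul_iff_algebraMap_injective _ _).2 hinj
  exact ⟨hflat, Algebra.IsIntegral.comap_surjective Γ(B, ⊤) Γ(A, ⊤)⟩

theorem finrank_of_finrank_eq {O : Type u} [CommRing O] [IsDomain O] {A : Scheme.{u}} [IsAffine A]
    (a : A ⟶ Spec (CommRingCat.of O)) [IsFinite a] [Flat a] {m : ℕ} (hm : ∀ s, a.finrank s = m) :
    letI := ((Scheme.ΓSpecIso (CommRingCat.of O)).inv ≫ a.appTop).hom.toAlgebra
    Module.Finite O Γ(A, ⊤) ∧ Module.Flat O Γ(A, ⊤) ∧ Module.finrank O Γ(A, ⊤) = m := by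
  let := ((Scheme.ΓSpecIso (CommRingCat.of O)).inv ≫ a.appTop).hom.toAlgebra
  have h : Spec.map (CommRingCat.ofHom (algebraMap O Γ(A, ⊤))) = A.isoSpec.inv ≫ a := by
    change Spec.map ((Scheme.ΓSpecIso (CommRingCat.of O)).inv ≫ a.appTop) = _
    rw [Spec.map_comp, ← Scheme.isoSpec_inv_naturality]
    congr 1
    simp [Scheme.isoSpec_Spec]
  have hflat : Module.Flat O Γ(A, ⊤) := by
    rw [← RingHom.flat_algebraMap_iff]
    exact Flat.SpecMap_iff.1 (h ▸ inferInstance)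
  have hfin : Module.Finite O Γ(A, ⊤) := by
    rw [← RingHom.finite_algebraMap]
    exact (IsFinite.SpecMap_iff _).1 (h ▸ inferInstance)
  refine ⟨hfin, hflat, ?_⟩
  -- The constant rank is evaluated at the generic point, where it is the rank over the domain.
  let s : PrimeSpectrum O := ⟨⊥, Ideal.isPrime_bot⟩
  rw [← Ideal.finrank_fiber_eq_finrank (⊥ : Ideal O), Ideal.finrank_fiber_eq_rankAtStalk,
    ← Scheme.Hom.finrank_SpecMap_algebraMap, h, Scheme.Hom.finrank_comp_left_of_isIso]
  exact hm _

theorem appTop_injective_of_isPullback {O : Type u} [CommRing O] [IsDomain O] [IsNoetherianRing O]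
    {A B Z : Scheme.{u}} [IsAffine A] [IsAffine B]
    {a : A ⟶ Spec (CommRingCat.of O)} {b : B ⟶ Spec (CommRingCat.of O)} [IsFinite a] [IsFinite b]
    [Flat a] [Flat b] {f : A ⟶ B} (hf : f ≫ b = a)
    {q₁ q₂ : Z ⟶ A} (h : IsPullback q₁ q₂ f f) [Flat q₁] [IsFinite q₁] {d m : ℕ} (hd0 : d ≠ 0)
    (hd : ∀ a, q₁.finrank a = d) (hb : ∀ s, b.finrank s = m) (ha : ∀ s, a.finrank s = d * m) :
    Function.Injective f.appTop.hom := by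
  let := f.appTop.hom.toAlgebra
  obtain ⟨h1, h2⟩ := flat_tensor_of_isPullback h hd
  let := ((Scheme.ΓSpecIso (CommRingCat.of O)).inv ≫ a.appTop).hom.toAlgebra
  let := ((Scheme.ΓSpecIso (CommRingCat.of O)).inv ≫ b.appTop).hom.toAlgebra
  obtain ⟨a1, a2, a3⟩ := finrank_of_finrank_eq a ha
  obtain ⟨b1, b2, b3⟩ := finrank_of_finrank_eq b hb
  have : IsScalarTower O Γ(B, ⊤) Γ(A, ⊤) := IsScalarTower.of_algebraMap_eq fun x => by
    subst hf
    rfl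
  have : Module.IsTorsionFree O Γ(B, ⊤) := inferInstance
  exact Module.algebraMap_injective_of_tensor_self (O := O) d hd0 h2 (by rw [a3, b3])

end AlgebraicGeometry

/-! ### Descent of properties, morphisms and group structures along fpqc maps -/

theorem RingHom.Flat.codescendsAlong_faithfullyFlat :
    RingHom.CodescendsAlong RingHom.Flat RingHom.FaithfullyFlat := by
  refine .mk _ RingHom.Flat.respectsIso fun R S T _ _ _ _ _ h h' => ?_
  rw [RingHom.flat_algebraMap_iff] at h' ⊢
  rw [RingHom.faithfullyFlat_algebraMap_iff] at h
  exact Module.Flat.of_flat_tensorProduct (R := R) (M := T) S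

namespace AlgebraicGeometry

instance Flat.descendsAlong :
    MorphismProperty.DescendsAlong @Flat (@Surjective ⊓ @Flat ⊓ @QuasiCompact) :=
  HasRingHomProperty.descendsAlong_flat RingHom.Flat.codescendsAlong_faithfullyFlat

end AlgebraicGeometry

namespace CategoryTheory.CommGrp

variable {C : Type u} [Category.{v} C] [CartesianMonoidalCategory C] [BraidedCategory C]

section
variable {J : Type w} [Category J] [HasLimitsOfShape J C]

instance preservesLimitsOfShape_forget : PreservesLimitsOfShape J (CommGrp.forget C) where
  preservesLimit {F} := by
    let L : CommGrp C :=
      { X := (limit (F ⋙ forget₂Grp C)).X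
        comm := isCommMonObj_limit F }
    have : CreatesLimit F (forget₂Grp C) :=
      createsLimitOfFullyFaithfulOfIso L (Iso.refl _)
    have : PreservesLimit F (forget₂Grp C) := inferInstance
    have : PreservesLimit F (forget₂Grp C ⋙ Grp.forget C) := inferInstance
    exact this
end

instance reflectsIsomorphisms_forget : (CommGrp.forget C).ReflectsIsomorphisms where
  reflects {A B} f hf := by
    have : IsIso f.hom.hom.hom := hf
    have : IsMonHom (asIso f.hom.hom.hom).hom := inferInstanceAs (IsMonHom f.hom.hom.hom)
    have h : f = (mkIso' (asIso f.hom.hom.hom)).hom := hom_ext _ _ rfl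
    rw [h]
    infer_instance

open scoped CategoryTheory.MonObj

theorem hom_zero (A B : CommGrp C) : (0 : A ⟶ B).hom.hom.hom = 1 := rfl

/-- A morphism killed by `q` factors through any kernel of `q`, even if it is not a homomorphism. -/
theorem exists_lift_of_isLimit [HasFiniteLimits C] {A B D : CommGrp C} {i : A ⟶ B} {q : B ⟶ D}
    {w : i ≫ q = 0} (h : IsLimit (KernelFork.ofι i w)) {Z : C} (z : Z ⟶ B.X)
    (hz : z ≫ q.hom.hom.hom = 1) : ∃ a : Z ⟶ A.X, a ≫ i.hom.hom.hom = z := by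
  have h' := isLimitForkMapOfIsLimit (CommGrp.forget C) _ h
  have hz' : z ≫ (CommGrp.forget C).map q = z ≫ (CommGrp.forget C).map (0 : B ⟶ D) := by
    change z ≫ q.hom.hom.hom = z ≫ (1 : B.X ⟶ D.X)
    rw [hz, MonObj.comp_one]
  exact ⟨h'.lift (Fork.ofι z hz'), h'.fac (Fork.ofι z hz') .zero⟩

end CategoryTheory.CommGrp

namespace CategoryTheory

open scoped CategoryTheory.MonObj

variable {C : Type u} [Category.{v} C] [CartesianMonoidalCategory C] [BraidedCategory C]

/-- The quotient of a commutative group object by a congruence is a group object. -/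
theorem GrpObj.exists_of_effectiveEpi {P Q : C} [GrpObj P] [IsCommMonObj P] (p : P ⟶ Q)
    [EffectiveEpi p] [EffectiveEpi (p ⊗ₘ p)] [Epi ((p ⊗ₘ p) ⊗ₘ p)]
    (hmul : ∀ {Z : C} (g₁ g₂ h₁ h₂ : Z ⟶ P), g₁ ≫ p = g₂ ≫ p → h₁ ≫ p = h₂ ≫ p →
      (g₁ * h₁) ≫ p = (g₂ * h₂) ≫ p)
    (hinv : ∀ {Z : C} (g₁ g₂ : Z ⟶ P), g₁ ≫ p = g₂ ≫ p → g₁⁻¹ ≫ p = g₂⁻¹ ≫ p) :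
    ∃ (_ : GrpObj Q), IsCommMonObj Q ∧ IsMonHom p := by
  let m : Q ⊗ Q ⟶ Q := EffectiveEpi.desc (p ⊗ₘ p) (μ ≫ p) (by
    intro Z g₁ g₂ h
    have h₁ : (g₁ ≫ fst P P) ≫ p = (g₂ ≫ fst P P) ≫ p := by
      simpa using h =≫ fst Q Q
    have h₂ : (g₁ ≫ snd P P) ≫ p = (g₂ ≫ snd P P) ≫ p := by
      simpa using h =≫ snd Q Q
    have := hmul _ _ _ _ h₁ h₂
    rwa [Hom.mul_def, Hom.mul_def, ← comp_lift, ← comp_lift, lift_fst_snd, Category.comp_id,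
      Category.comp_id, Category.assoc, Category.assoc] at this)
  have hm : (p ⊗ₘ p) ≫ m = μ ≫ p := EffectiveEpi.fac _ _ _
  let n : Q ⟶ Q := EffectiveEpi.desc p (ι ≫ p) (by
    intro Z g₁ g₂ h
    simpa [Hom.inv_def] using hinv _ _ h)
  have hn : p ≫ n = ι ≫ p := EffectiveEpi.fac _ _ _
  have hm' {Z : C} (a b : Z ⟶ P) : lift (a ≫ p) (b ≫ p) ≫ m = (a * b) ≫ p := by
    rw [← lift_map, Category.assoc, hm, Hom.mul_def, Category.assoc]
  have h_one : (η ≫ p) ▷ Q ≫ m = (λ_ Q).hom := by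
    rw [← cancel_epi (λ_ Q).inv, ← cancel_epi p, Iso.inv_hom_id, Category.comp_id]
    have : p ≫ (λ_ Q).inv ≫ (η ≫ p) ▷ Q = lift ((1 : P ⟶ P) ≫ p) (𝟙 P ≫ p) := by
      ext <;> simp [Hom.one_def]
    rw [← Category.assoc, ← Category.assoc, Category.assoc p, this, hm', one_mul, Category.id_comp]
  -- Commutativity is proved early so that the right unit and right inverse laws follow from the
  -- left ones.
  have h_comm : (β_ Q Q).hom ≫ m = m := by
    rw [← cancel_epi (p ⊗ₘ p), BraidedCategory.braiding_naturality_assoc, hm,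
      IsCommMonObj.mul_comm_assoc]
  have h_one' : Q ◁ (η ≫ p) ≫ m = (ρ_ Q).hom := by
    rw [← h_comm, BraidedCategory.braiding_naturality_right_assoc, h_one]
    simp
  have h_assoc : m ▷ Q ≫ m = (α_ Q Q Q).hom ≫ Q ◁ m ≫ m := by
    rw [← cancel_epi ((p ⊗ₘ p) ⊗ₘ p)]
    have h₁ : ((p ⊗ₘ p) ⊗ₘ p) ≫ m ▷ Q = μ ▷ P ≫ (p ⊗ₘ p) := by
      rw [← tensorHom_id, tensorHom_comp_tensorHom, hm, Category.comp_id, ← tensorHom_id,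
        tensorHom_comp_tensorHom, Category.id_comp]
    have h₂ : (p ⊗ₘ (p ⊗ₘ p)) ≫ Q ◁ m = P ◁ μ ≫ (p ⊗ₘ p) := by
      rw [← id_tensorHom, tensorHom_comp_tensorHom, hm, Category.comp_id, ← id_tensorHom,
        tensorHom_comp_tensorHom, Category.id_comp]
    rw [← Category.assoc, h₁, Category.assoc, hm, ← Category.assoc _ _ (Q ◁ m ≫ m),
      associator_naturality, Category.assoc, ← Category.assoc _ (Q ◁ m), h₂, Category.assoc, hm,
      MonObj.mul_assoc_assoc]
  have h_inv : lift n (𝟙 Q) ≫ m = toUnit Q ≫ η ≫ p := by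
    rw [← cancel_epi p, comp_lift_assoc, hn]
    have := hm' (𝟙 P)⁻¹ (𝟙 P)
    rw [inv_mul_cancel, Hom.one_def, Hom.inv_def, Category.id_comp] at this
    simpa using this
  have h_inv' : lift (𝟙 Q) n ≫ m = toUnit Q ≫ η ≫ p := by
    rw [← h_inv, ← h_comm, ← Category.assoc, lift_braiding_hom, h_comm]
  let _ : MonObj Q :=
    { one := η ≫ p, mul := m, one_mul := h_one, mul_one := h_one', mul_assoc := h_assoc }
  exact ⟨{ inv := n, left_inv := h_inv, right_inv := h_inv' }, ⟨h_comm⟩, ⟨rfl, hm.symm⟩⟩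

end CategoryTheory

instance Over.effectiveEpi_of_left {T : Type u} [Category.{v} T] {S : T} {X Y : Over S} (f : X ⟶ Y)
    [EffectiveEpi f.left] : EffectiveEpi f := by
  have key {W : Over S} (e : X ⟶ W)
      (h : ∀ {Z : Over S} (g₁ g₂ : Z ⟶ X), g₁ ≫ f = g₂ ≫ f → g₁ ≫ e = g₂ ≫ e) :
      ∀ {Z : T} (g₁ g₂ : Z ⟶ X.left), g₁ ≫ f.left = g₂ ≫ f.left → g₁ ≫ e.left = g₂ ≫ e.left := by
    intro Z g₁ g₂ hg
    have hw : g₂ ≫ X.hom = g₁ ≫ X.hom := by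
      rw [← Over.w f, ← Category.assoc, ← hg, Category.assoc]
    exact congrArg CommaMorphism.left (h (Z := Over.mk (g₁ ≫ X.hom)) (Over.homMk g₁ rfl)
      (Over.homMk g₂ hw) (Over.OverMorphism.ext hg))
  exact ⟨⟨{
    desc := fun {W} e h => Over.homMk (EffectiveEpi.desc f.left e.left (key e h)) (by
      rw [← cancel_epi f.left, ← Category.assoc, EffectiveEpi.fac, Over.w, Over.w])
    fac := fun e h => Over.OverMorphism.ext (EffectiveEpi.fac f.left e.left (key e h))
    uniq := fun e h m hm => Over.OverMorphism.ext
      (EffectiveEpi.uniq f.left e.left (key e h) _ (congrArg CommaMorphism.left hm)) }⟩⟩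

namespace AlgebraicGeometry

/-- Faithfully flat and quasi-compact morphisms. -/
abbrev fpqc : MorphismProperty Scheme.{u} := @Surjective ⊓ @Flat ⊓ @QuasiCompact

instance fpqc.isStableUnderBaseChange : fpqc.{u}.IsStableUnderBaseChange :=
  have : (@Surjective ⊓ @Flat : MorphismProperty Scheme.{u}).IsStableUnderBaseChange := .inf
  .inf

instance fpqc.isStableUnderComposition : fpqc.{u}.IsStableUnderComposition where
  comp_mem f g hf hg := by
    obtain ⟨⟨_, _⟩, _⟩ := hf
    obtain ⟨⟨_, _⟩, _⟩ := hg
    exact ⟨⟨inferInstance, inferInstance⟩, inferInstance⟩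

theorem fpqc.effectiveEpi {X Y : Scheme.{u}} {f : X ⟶ Y} (h : fpqc f) : EffectiveEpi f := by
  obtain ⟨⟨_, _⟩, _⟩ := h
  infer_instance

theorem fpqc.tensorHom {S : Scheme.{u}} {X Y Z W : Over S} {f : X ⟶ Y} {g : Z ⟶ W}
    (hf : fpqc f.left) (hg : fpqc g.left) : fpqc (f ⊗ₘ g).left := by
  rw [Over.tensorHom_left]
  exact MorphismProperty.pullbackMap (P := fpqc) hf hg (Over.w f).symm (Over.w g).symm

end AlgebraicGeometry

open scoped CategoryTheory.MonObj in
theorem CategoryTheory.IsMonHom.of_epi {C : Type u} [Category.{v} C] [CartesianMonoidalCategory C]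
    {P Q T : C} [MonObj P] [MonObj Q] [MonObj T] (p : P ⟶ Q) (g : Q ⟶ T) [IsMonHom p]
    [IsMonHom (p ≫ g)] [Epi (p ⊗ₘ p)] : IsMonHom g where
  one_hom := by
    rw [← IsMonHom.one_hom p, Category.assoc, IsMonHom.one_hom]
  mul_hom := by
    rw [← cancel_epi (p ⊗ₘ p), ← IsMonHom.mul_hom_assoc, IsMonHom.mul_hom,
      tensorHom_comp_tensorHom_assoc]

/-! ### Short exact sequences of finite flat group schemes -/

namespace CommGroupScheme

variable {O : Type u} [CommRing O]

variable (O) in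
/-- The functor sending a group scheme to its underlying scheme. -/
noncomputable abbrev toScheme : CommGroupScheme O ⥤ Scheme.{u} := CommGrp.forget _ ⋙ Over.forget _

theorem isPullback_schemeMap {W X Y Z : CommGroupScheme O} {f : W ⟶ X} {g : W ⟶ Y} {h : X ⟶ Z}
    {k : Y ⟶ Z} (sq : IsPullback f g h k) :
    IsPullback (schemeMap f) (schemeMap g) (schemeMap h) (schemeMap k) :=
  sq.map (toScheme O)

theorem schemeMap_comp_structureMap {X Y : CommGroupScheme O} (f : X ⟶ Y) :
    schemeMap f ≫ Y.structureMap = X.structureMap := Over.w f.hom.hom.hom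

theorem schemeMap_comp {X Y Z : CommGroupScheme O} (f : X ⟶ Y) (g : Y ⟶ Z) :
    schemeMap (f ≫ g) = schemeMap f ≫ schemeMap g := rfl

variable {A B D A' B' D' X Y Z : CommGroupScheme O}

theorem IsFiniteFlat.isFinite_schemeMap (hX : IsFiniteFlat X) (hY : IsFiniteFlat Y) (f : X ⟶ Y) :
    IsFinite (schemeMap f) := by
  have := hX.finite
  have := hY.finite
  have : IsFinite (schemeMap f ≫ Y.structureMap) := by rwa [schemeMap_comp_structureMap]
  exact IsFinite.of_comp (schemeMap f) Y.structureMap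

theorem IsFiniteFlat.of_schemeMap (hY : IsFiniteFlat Y) (f : X ⟶ Y) [IsFinite (schemeMap f)]
    [Flat (schemeMap f)] : IsFiniteFlat X := by
  have := hY.finite
  have := hY.flat
  constructor
  · rw [← schemeMap_comp_structureMap f]; infer_instance
  · rw [← schemeMap_comp_structureMap f]; infer_instance

theorem IsFiniteFlat.of_iso (hY : IsFiniteFlat Y) (e : X ≅ Y) : IsFiniteFlat X :=
  have : IsIso (schemeMap e.hom) := inferInstanceAs (IsIso ((toScheme O).map e.hom))
  hY.of_schemeMap e.hom

theorem IsFiniteFlat.isAffine (hX : IsFiniteFlat X) : IsAffine X.X.left :=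
  have := hX.finite
  isAffine_of_isAffineHom X.structureMap

theorem IsFiniteFlat.isClosedFlatSubgroup (hX : IsFiniteFlat X) (hY : IsFiniteFlat Y) (f : X ⟶ Y)
    [Mono f] : IsClosedFlatSubgroup f where
  closed := by
    have := hX.isFinite_schemeMap hY f
    have : Mono (schemeMap f) := inferInstanceAs (Mono ((toScheme O).map f))
    exact IsClosedImmersion.iff_isFinite_and_mono _ |>.2 ⟨inferInstance, inferInstance⟩
  flat := hX.flat

theorem epi_of_fpqc {q : B ⟶ D} (h : fpqc (schemeMap q)) : Epi q :=
  have := h.effectiveEpi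
  have : Epi ((toScheme O).map q) := inferInstanceAs (Epi (schemeMap q))
  (toScheme O).epi_of_epi_map this

namespace IsShortExact

theorem mk' {i : A ⟶ B} {q : B ⟶ D} [Mono i] (w : i ≫ q = 0)
    (h : ∀ {Z : CommGroupScheme O} (z : Z ⟶ B), z ≫ q = 0 → ∃ a, a ≫ i = z) [Flat (schemeMap q)]
    [Surjective (schemeMap q)] : IsShortExact i q where
  comp_eq_zero := w
  isKernel := ⟨KernelFork.IsLimit.ofι' i w fun z hz => ⟨(h z hz).choose, (h z hz).choose_spec⟩⟩
  flat := inferInstance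
  surjective := inferInstance

variable {i : A ⟶ B} {q : B ⟶ D}

theorem mono (h : IsShortExact i q) : Mono i := by
  obtain ⟨hk⟩ := h.isKernel
  exact ⟨fun a b hab => Fork.IsLimit.hom_ext hk hab⟩

theorem exists_lift (h : IsShortExact i q) {Z : CommGroupScheme O} (z : Z ⟶ B) (hz : z ≫ q = 0) :
    ∃ a, a ≫ i = z := by
  obtain ⟨hk⟩ := h.isKernel
  exact ⟨hk.lift (KernelFork.ofι z hz), hk.fac (KernelFork.ofι z hz) .zero⟩

theorem fpqc (h : IsShortExact i q) (hB : IsFiniteFlat B) (hD : IsFiniteFlat D) :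
    fpqc (schemeMap q) :=
  have := hB.isFinite_schemeMap hD q
  ⟨⟨h.surjective, h.flat⟩, inferInstance⟩

theorem epi (h : IsShortExact i q) (hB : IsFiniteFlat B) (hD : IsFiniteFlat D) : Epi q :=
  epi_of_fpqc (h.fpqc hB hD)

-- Two points of `B` with the same image in `D` differ by a point of `A`, which `f` kills; since `q`
-- is an effective epimorphism of schemes, `f` descends as a morphism. It is a homomorphism because
-- `q × q` is an epimorphism.
open scoped CategoryTheory.MonObj in
theorem exists_desc (h : IsShortExact i q) (hB : IsFiniteFlat B) (hD : IsFiniteFlat D)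
    (f : B ⟶ X) (hf : i ≫ f = 0) : ∃ g, q ≫ g = f := by
  have := (h.fpqc hB hD).effectiveEpi
  have : EffectiveEpi q.hom.hom.hom := Over.effectiveEpi_of_left _
  have := ((h.fpqc hB hD).tensorHom (f := q.hom.hom.hom) (g := q.hom.hom.hom)
    (h.fpqc hB hD)).effectiveEpi
  have : EffectiveEpi (q.hom.hom.hom ⊗ₘ q.hom.hom.hom) := Over.effectiveEpi_of_left _
  obtain ⟨hk⟩ := h.isKernel
  let g : D.X ⟶ X.X := EffectiveEpi.desc q.hom.hom.hom f.hom.hom.hom (by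
    intro Z g₁ g₂ hg
    obtain ⟨a, ha⟩ := CommGrp.exists_lift_of_isLimit hk (g₁ / g₂) (by
      rw [GrpObj.div_comp, hg, div_self'])
    rw [eq_div_iff_mul_eq'] at ha
    have hf' : i.hom.hom.hom ≫ f.hom.hom.hom = 1 := congrArg (fun f => f.hom.hom.hom) hf
    rw [← ha, MonObj.mul_comp, Category.assoc, hf', MonObj.comp_one, one_mul])
  have hg : q.hom.hom.hom ≫ g = f.hom.hom.hom := EffectiveEpi.fac _ _ _
  have : IsMonHom (q.hom.hom.hom ≫ g) := by rw [hg]; infer_instance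
  have : IsMonHom g := .of_epi q.hom.hom.hom g
  exact ⟨InducedCategory.homMk (Grp.homMk g), CommGrp.hom_ext _ _ hg⟩

theorem of_isPullback (h : IsShortExact i q) {t : B' ⟶ B} {q' : B' ⟶ D'} {g : D' ⟶ D}
    (sq : IsPullback t q' q g) : IsShortExact (sq.lift i 0 (by simp [h.comp_eq_zero])) q' := by
  have := h.mono
  have := h.flat
  have := h.surjective
  have sq' := isPullback_schemeMap sq
  have : Flat (schemeMap q') := MorphismProperty.of_isPullback sq' inferInstance
  have : Surjective (schemeMap q') := MorphismProperty.of_isPullback sq' inferInstance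
  have : Mono (sq.lift i 0 (by simp [h.comp_eq_zero])) := by
    have : Mono (sq.lift i 0 (by simp [h.comp_eq_zero]) ≫ t) := by rwa [sq.lift_fst]
    exact mono_of_mono _ t
  refine .mk' (sq.lift_snd _ _ _) fun z hz => ?_
  obtain ⟨a, ha⟩ := h.exists_lift (z ≫ t) (by rw [Category.assoc, sq.w, reassoc_of% hz, zero_comp])
  exact ⟨a, sq.hom_ext (by simp [ha]) (by simp [hz])⟩

theorem isFiniteFlat_of_isPullback (h : IsShortExact i q) (hB : IsFiniteFlat B)
    (hD : IsFiniteFlat D) (hD' : IsFiniteFlat D') {t : B' ⟶ B} {q' : B' ⟶ D'} {g : D' ⟶ D}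
    (sq : IsPullback t q' q g) : IsFiniteFlat B' := by
  have sq' := isPullback_schemeMap sq
  have := h.flat
  have := hB.isFinite_schemeMap hD q
  have : Flat (schemeMap q') := MorphismProperty.of_isPullback sq' inferInstance
  have : IsFinite (schemeMap q') := MorphismProperty.of_isPullback sq' inferInstance
  exact hD'.of_schemeMap q'

theorem comp_isIso (h : IsShortExact i q) (α : A' ⟶ A) (δ : D ⟶ D') [IsIso α] [IsIso δ] :
    IsShortExact (α ≫ i) (q ≫ δ) := by
  have := h.mono
  have := h.flat
  have := h.surjective
  have : IsIso (schemeMap δ) := inferInstanceAs (IsIso ((toScheme O).map δ))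
  have : Flat (schemeMap (q ≫ δ)) := by rw [schemeMap_comp]; infer_instance
  have : Surjective (schemeMap (q ≫ δ)) := by rw [schemeMap_comp]; infer_instance
  refine .mk' (by simp [reassoc_of% h.comp_eq_zero]) fun z hz => ?_
  obtain ⟨a, ha⟩ := h.exists_lift z (by
    rwa [← Category.assoc, Preadditive.IsIso.comp_right_eq_zero] at hz)
  exact ⟨a ≫ inv α, by simp [ha]⟩

/-- The five lemma for extensions. -/
theorem isIso_of_id {i' : A ⟶ B'} {q' : B' ⟶ D} (h : IsShortExact i q)
    (h' : IsShortExact i' q') (hB : IsFiniteFlat B) (hB' : IsFiniteFlat B') (hD : IsFiniteFlat D)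
    (f : B ⟶ B') (hi : i ≫ f = i') (hq : f ≫ q' = q) : IsIso f := by
  -- The inverse is found on `B ×_D B'`: for a point `(x, y)` the difference `y - f x` comes from
  -- `A`, so `x + i (y - f x)` is the preimage of `y`. This is independent of `x` and descends along
  -- the second projection.
  have sq := IsPullback.of_hasPullback q q'
  set x := pullback.fst q q'
  set y := pullback.snd q q'
  have hE := h.of_isPullback sq
  have hEf := h.isFiniteFlat_of_isPullback hB hD hB' sq
  obtain ⟨a, ha⟩ := h'.exists_lift (y - x ≫ f) (by
    rw [Preadditive.sub_comp, Category.assoc, hq, sq.w, sub_self])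
  have := h'.mono
  obtain ⟨g, hg⟩ := hE.exists_desc hEf hB' (x + a ≫ i) (by
    have : sq.lift i 0 (by simp [h.comp_eq_zero]) ≫ a = -𝟙 _ := by
      rw [← cancel_mono i', Category.assoc, ha]
      simp [Preadditive.comp_sub, hi]
    simp [Preadditive.comp_add, reassoc_of% this])
  have := hE.epi hEf hB'
  refine ⟨g, ?_, ?_⟩
  · have hl : sq.lift (𝟙 B) f (by simp [hq]) ≫ a = 0 := by
      rw [← cancel_mono i', Category.assoc, ha]
      simp [Preadditive.comp_sub]
    have := sq.lift (𝟙 B) f (by simp [hq]) ≫= hg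
    simpa [Preadditive.comp_add, reassoc_of% hl] using this
  · rw [← cancel_epi y, reassoc_of% hg, Preadditive.add_comp, Category.assoc, hi, ha]
    simp

theorem isIso {i' : A' ⟶ B'} {q' : B' ⟶ D'} (h : IsShortExact i q)
    (h' : IsShortExact i' q') (hB : IsFiniteFlat B) (hB' : IsFiniteFlat B') (hD : IsFiniteFlat D)
    (f : B ⟶ B') (α : A ⟶ A') (δ : D ⟶ D') [IsIso α] [IsIso δ]
    (hi : i ≫ f = α ≫ i') (hq : f ≫ q' = q ≫ δ) : IsIso f :=
  h.isIso_of_id (h'.comp_isIso α (inv δ)) hB hB' hD f hi (by rw [reassoc_of% hq]; simp)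

end IsShortExact

end CommGroupScheme

/-! ### Quotients obtained by descent -/

instance AlgebraicGeometry.LocallyOfFiniteType.descendsAlong :
    MorphismProperty.DescendsAlong @LocallyOfFiniteType fpqc.{u} :=
  HasRingHomProperty.descendsAlong_flat RingHom.FiniteType.codescendsAlong_faithfullyFlat

/-- Finite means proper and affine. Universal closedness and finite type descend along `h`, while
affineness and separatedness of `k` are automatic between affine schemes. -/
theorem AlgebraicGeometry.isFinite_of_isPullback {W X Y Z : Scheme.{u}} [IsAffine X] [IsAffine Z]
    {f : W ⟶ X} {g : W ⟶ Y} {h : X ⟶ Z} {k : Y ⟶ Z} (sq : IsPullback f g h k) [IsAffine Y]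
    (hh : fpqc h) [IsFinite f] : IsFinite k := by
  have : UniversallyClosed k := MorphismProperty.of_isPullback_of_descendsAlong
    (P := @UniversallyClosed) (Q := fpqc) sq hh inferInstance
  have : LocallyOfFiniteType k := MorphismProperty.of_isPullback_of_descendsAlong
    (P := @LocallyOfFiniteType) (Q := fpqc) sq hh inferInstance
  have : IsProper k := ⟨⟩
  rw [IsFinite.iff_isProper_and_isAffineHom]
  exact ⟨inferInstance, inferInstance⟩

namespace CommGroupScheme

variable {O : Type u} [CommRing O] {A B D A' B' D' X Y Z : CommGroupScheme O}

theorem hasBinaryBiproducts : HasBinaryBiproducts (CommGroupScheme O) :=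
  hasBinaryBiproducts_of_finite_biproducts _

attribute [local instance] hasBinaryBiproducts

theorem isPullback_biprod (X Y : CommGroupScheme O) :
    IsPullback (schemeMap (biprod.snd : X ⊞ Y ⟶ Y)) (schemeMap (biprod.fst : X ⊞ Y ⟶ X))
      Y.structureMap X.structureMap := by
  let T : CommGroupScheme O := CommGrp.trivial _
  have hT : IsZero T := ⟨fun Z => ⟨CommGrp.uniqueHomFromTrivial Z⟩, fun Z => ⟨⟨⟨0⟩, fun f =>
    CommGrp.hom_ext _ _ (toUnit_unique _ _)⟩⟩⟩
  have sq : IsPullback (biprod.snd : X ⊞ Y ⟶ Y) (biprod.fst : X ⊞ Y ⟶ X) (0 : Y ⟶ T) 0 :=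
    ⟨⟨hT.eq_of_tgt _ _⟩, ⟨PullbackCone.IsLimit.mk _ (fun s => biprod.lift s.snd s.fst)
      (by simp) (by simp) fun s m h₁ h₂ => biprod.hom_ext _ _ (by simp [h₂]) (by simp [h₁])⟩⟩
  have h0 (Z : CommGroupScheme O) : schemeMap (0 : Z ⟶ T) = Z.structureMap :=
    (Category.comp_id _).symm.trans (schemeMap_comp_structureMap (0 : Z ⟶ T))
  have := isPullback_schemeMap sq
  rwa [h0, h0] at this

theorem IsFiniteFlat.biprod (hX : IsFiniteFlat X) (hY : IsFiniteFlat Y) : IsFiniteFlat (X ⊞ Y) := by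
  have := hY.finite
  have := hY.flat
  have sq := isPullback_biprod X Y
  have : IsFinite (schemeMap (biprod.fst : X ⊞ Y ⟶ X)) :=
    MorphismProperty.of_isPullback sq inferInstance
  have : Flat (schemeMap (biprod.fst : X ⊞ Y ⟶ X)) :=
    MorphismProperty.of_isPullback sq inferInstance
  exact hX.of_schemeMap biprod.fst

-- Here `P'` is the quotient of `P` by `A`. As `E → S` is an `A`-torsor and `P → E` is equivariant,
-- the translation action of `A` is a descent datum for `P` along `E → S`, and no general theorem on
-- quotients by finite group schemes is needed.
open scoped CategoryTheory.MonObj in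
theorem IsShortExact.exists_descent {E S P : CommGroupScheme O} {inc : A ⟶ E} {π : E ⟶ S}
    (h : IsShortExact inc π) (hA : IsFiniteFlat A) (hE : IsFiniteFlat E) (hS : IsFiniteFlat S)
    (hP : IsFiniteFlat P) {ρ : P ⟶ E} [Flat (schemeMap ρ)] [Surjective (schemeMap ρ)] {σ : A ⟶ P}
    (hσ : σ ≫ ρ = inc) :
    ∃ (P' : CommGroupScheme O) (p : P ⟶ P') (s : P' ⟶ S), IsFiniteFlat P' ∧
      IsPullback ρ p π s ∧ IsShortExact σ p ∧ Flat (schemeMap s) ∧ Surjective (schemeMap s) := by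
  have := h.mono
  have : Mono σ := by
    have : Mono (σ ≫ ρ) := by rwa [hσ]
    exact mono_of_mono σ ρ
  have hσπ : σ ≫ ρ ≫ π = 0 := by rw [reassoc_of% hσ, h.comp_eq_zero]
  -- The pair to be coequalized is the action `f : (x, a) ↦ x + σ a` and the projection.
  set f : P ⊞ A ⟶ P := biprod.fst + biprod.snd ≫ σ with hf
  have hfg : f ≫ ρ ≫ π = biprod.fst ≫ ρ ≫ π := by
    simp [hf, Preadditive.add_comp, hσπ]
  have sqP := IsPullback.of_hasPullback π (ρ ≫ π)
  have sqW := IsPullback.of_hasPullback π (f ≫ ρ ≫ π)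
  set x₁ := pullback.fst π (ρ ≫ π)
  set x₂ := pullback.snd π (ρ ≫ π)
  set w₁ := pullback.fst π (f ≫ ρ ≫ π)
  set w₂ := pullback.snd π (f ≫ ρ ≫ π)
  let ef := sqP.lift w₁ (w₂ ≫ f) (by simp [sqW.w])
  let eg := sqP.lift w₁ (w₂ ≫ biprod.fst) (by simp [sqW.w, hfg])
  -- On `E ×_S P` the point `d (e, x)` of `A` is the difference `e - ρ x`. Translating `x` by it
  -- gives the point `y` over `e`, and this translation splits the fork after base change to `E`.
  obtain ⟨d, hd⟩ := h.exists_lift (x₁ - x₂ ≫ ρ) (by simp [Preadditive.sub_comp, sqP.w])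
  have hefd : ef ≫ d = eg ≫ d - w₂ ≫ biprod.snd := by
    rw [← cancel_mono inc]
    simp [Preadditive.sub_comp, hd, Preadditive.comp_sub, ef, eg, hf, Preadditive.add_comp,
      Preadditive.comp_add, hσ, sub_sub]
  set y := x₂ + d ≫ σ with hy
  have hyρ : y ≫ ρ = x₁ := by simp [hy, Preadditive.add_comp, hσ, hd]
  let s := sqP.lift ρ (𝟙 P) (by simp)
  have hsd : s ≫ d = 0 := by
    rw [← cancel_mono inc]
    simp [hd, Preadditive.comp_sub, s]
  have hsy : s ≫ y = 𝟙 P := by simp [hy, Preadditive.comp_add, reassoc_of% hsd, s]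
  have hefy : ef ≫ y = eg ≫ y := by
    rw [hy, Preadditive.comp_add, Preadditive.comp_add, reassoc_of% hefd]
    simp [ef, eg, hf, Preadditive.sub_comp, Preadditive.comp_add]
  have htf' : biprod.lift x₂ d ≫ f = y := by simp [hf, hy, Preadditive.comp_add]
  let t := sqW.lift x₁ (biprod.lift x₂ d) (by rw [reassoc_of% htf', reassoc_of% hyρ])
  have htf : t ≫ ef = y ≫ s := sqP.hom_ext (by simp [t, ef, s, hyρ]) (by simp [t, ef, s, htf'])
  have htg : t ≫ eg = 𝟙 _ := sqP.hom_ext (by simp [t, eg]) (by simp [t, eg])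
  have := hP.isAffine
  have := hE.isAffine
  have := hS.isAffine
  have := hA.isAffine
  have := h.flat
  have hW : IsFiniteFlat (P ⊞ A) := hP.biprod hA
  have := hW.isAffine
  obtain ⟨Q, p₀, s₀, hQ, hfp, sq⟩ := Scheme.exists_isPullback_of_split
    (congrArg schemeMap hfg) (isPullback_schemeMap sqP) (isPullback_schemeMap sqW)
    (congrArg schemeMap (sqP.lift_fst _ _ _ : ef ≫ x₁ = w₁))
    (congrArg schemeMap (sqP.lift_snd _ _ _ : ef ≫ x₂ = w₂ ≫ f))
    (congrArg schemeMap (sqP.lift_fst _ _ _ : eg ≫ x₁ = w₁))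
    (congrArg schemeMap (sqP.lift_snd _ _ _ : eg ≫ x₂ = w₂ ≫ biprod.fst))
    (congrArg schemeMap (sqP.lift_fst _ _ _ : s ≫ x₁ = ρ))
    (congrArg schemeMap (sqP.lift_snd _ _ _ : s ≫ x₂ = 𝟙 P))
    (congrArg schemeMap hefy) (congrArg schemeMap hsy) (congrArg schemeMap htf)
    (congrArg schemeMap htg)
  let Q' : Over (Spec (CommRingCat.of O)) := Over.mk (s₀ ≫ S.structureMap)
  let p' : P.X ⟶ Q' := Over.homMk p₀ (by
    change p₀ ≫ s₀ ≫ S.structureMap = P.structureMap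
    rw [← sq.w_assoc, schemeMap_comp_structureMap, schemeMap_comp_structureMap])
  let s' : Q' ⟶ S.X := Over.homMk s₀ rfl
  have hsq' : ρ.hom.hom.hom ≫ π.hom.hom.hom = p' ≫ s' := Over.OverMorphism.ext sq.w
  have hext {Z : Over (Spec (CommRingCat.of O))} {g₁ g₂ : Z ⟶ P.X}
      (h₁ : g₁ ≫ ρ.hom.hom.hom = g₂ ≫ ρ.hom.hom.hom) (h₂ : g₁ ≫ p' = g₂ ≫ p') : g₁ = g₂ :=
    Over.OverMorphism.ext (sq.hom_ext (congrArg CommaMorphism.left h₁)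
      (congrArg CommaMorphism.left h₂))
  have hfp' : f.hom.hom.hom ≫ p' = (biprod.fst : P ⊞ A ⟶ P).hom.hom.hom ≫ p' :=
    Over.OverMorphism.ext hfp
  have hmulp {Z : Over (Spec (CommRingCat.of O))} (g : Z ⟶ P.X) (a : Z ⟶ A.X) :
      (g * a ≫ σ.hom.hom.hom) ≫ p' = g ≫ p' := by
    let l : P.X ⟶ (P ⊞ A).X := (biprod.inl : P ⟶ P ⊞ A).hom.hom.hom
    let r : A.X ⟶ (P ⊞ A).X := (biprod.inr : A ⟶ P ⊞ A).hom.hom.hom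
    have hlf : l ≫ f.hom.hom.hom = 𝟙 _ :=
      congrArg (fun f => f.hom.hom.hom) (show biprod.inl ≫ f = 𝟙 P by simp [hf])
    have hrf : r ≫ f.hom.hom.hom = σ.hom.hom.hom :=
      congrArg (fun f => f.hom.hom.hom) (show biprod.inr ≫ f = σ by simp [hf])
    have hlf' : l ≫ (biprod.fst : P ⊞ A ⟶ P).hom.hom.hom = 𝟙 _ :=
      congrArg (fun f => f.hom.hom.hom) (biprod.inl_fst : biprod.inl ≫ biprod.fst = 𝟙 P)
    have hrf' : r ≫ (biprod.fst : P ⊞ A ⟶ P).hom.hom.hom = 1 :=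
      congrArg (fun f => f.hom.hom.hom) (biprod.inr_fst : (biprod.inr : A ⟶ P ⊞ A) ≫ _ = 0)
    have h₁ : (g ≫ l * a ≫ r) ≫ f.hom.hom.hom = g * a ≫ σ.hom.hom.hom := by
      rw [MonObj.mul_comp, Category.assoc, Category.assoc, hlf, hrf, Category.comp_id]
    have h₂ : (g ≫ l * a ≫ r) ≫ (biprod.fst : P ⊞ A ⟶ P).hom.hom.hom = g := by
      rw [MonObj.mul_comp, Category.assoc, Category.assoc, hlf', hrf', Category.comp_id,
        MonObj.comp_one, mul_one]
    rw [← h₁, Category.assoc, hfp', ← Category.assoc, h₂]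
  -- Fibres of `p'` are exactly `A`-orbits: the images in `E` differ by a point of `A`, and a point
  -- of `P = E ×_S P'` is determined by its two projections. Hence the group law passes to the
  -- quotient.
  have hex {Z : Over (Spec (CommRingCat.of O))} {g₁ g₂ : Z ⟶ P.X} (hg : g₁ ≫ p' = g₂ ≫ p') :
      ∃ a : Z ⟶ A.X, g₁ = g₂ * a ≫ σ.hom.hom.hom := by
    obtain ⟨hk⟩ := h.isKernel
    obtain ⟨a, ha⟩ := CommGrp.exists_lift_of_isLimit hk
      ((g₁ ≫ ρ.hom.hom.hom) / (g₂ ≫ ρ.hom.hom.hom)) (by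
        rw [GrpObj.div_comp, Category.assoc, Category.assoc, hsq', reassoc_of% hg, div_self'])
    refine ⟨a, hext ?_ ?_⟩
    · have hσ' : σ.hom.hom.hom ≫ ρ.hom.hom.hom = inc.hom.hom.hom :=
        congrArg (fun f => f.hom.hom.hom) hσ
      rw [MonObj.mul_comp, Category.assoc, hσ', ha, mul_div_cancel]
    · rw [hmulp, hg]
  have hp₀ : AlgebraicGeometry.fpqc p₀ :=
    MorphismProperty.of_isPullback (P := AlgebraicGeometry.fpqc) sq (h.fpqc hE hS)
  have hpp : AlgebraicGeometry.fpqc (p' ⊗ₘ p').left :=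
    AlgebraicGeometry.fpqc.tensorHom (f := p') (g := p') hp₀ hp₀
  have hppp : AlgebraicGeometry.fpqc ((p' ⊗ₘ p') ⊗ₘ p').left :=
    AlgebraicGeometry.fpqc.tensorHom (g := p') hpp hp₀
  have : EffectiveEpi p'.left := hp₀.effectiveEpi
  have := hpp.effectiveEpi
  have := hppp.effectiveEpi
  obtain ⟨_, _, _⟩ := GrpObj.exists_of_effectiveEpi p' (by
    intro Z g₁ g₂ h₁ h₂ hg hh
    obtain ⟨a, rfl⟩ := hex hg
    obtain ⟨b, rfl⟩ := hex hh
    rw [mul_mul_mul_comm, ← MonObj.mul_comp, hmulp]) (by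
    intro Z g₁ g₂ hg
    obtain ⟨a, rfl⟩ := hex hg
    rw [mul_inv, ← GrpObj.inv_comp, hmulp])
  have : IsMonHom (p' ≫ s') := by rw [← hsq']; infer_instance
  have : IsMonHom s' := .of_epi p' s'
  let P' : CommGroupScheme O := { X := Q' }
  let p : P ⟶ P' := InducedCategory.homMk (Grp.homMk p')
  let sP : P' ⟶ S := InducedCategory.homMk (Grp.homMk s')
  have sq' : IsPullback ρ p π sP := by
    have : ReflectsLimit (cospan π sP) (toScheme O) :=
      reflectsLimit_of_reflectsIsomorphisms _ _
    exact IsPullback.of_map (toScheme O) (CommGrp.hom_ext _ _ hsq') sq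
  have hσp : σ ≫ p = 0 := by
    apply CommGrp.hom_ext
    have := hmulp (1 : A.X ⟶ P.X) (𝟙 A.X)
    rw [one_mul, Category.id_comp] at this
    rw [CommGrp.hom_zero]
    exact this.trans (MonObj.one_comp (f := p.hom.hom.hom))
  have hρ : AlgebraicGeometry.fpqc (schemeMap ρ) :=
    have := hP.isFinite_schemeMap hE ρ
    ⟨⟨inferInstance, inferInstance⟩, inferInstance⟩
  have := hP.isFinite_schemeMap hE ρ
  have : Flat (schemeMap p) := hp₀.1.2
  have : Surjective (schemeMap p) := hp₀.1.1
  have : IsFinite s₀ := isFinite_of_isPullback sq (h.fpqc hE hS)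
  have : IsFinite (schemeMap sP) := this
  have : Flat (schemeMap sP) := MorphismProperty.of_isPullback_of_descendsAlong
    (P := @Flat) (Q := AlgebraicGeometry.fpqc) sq (h.fpqc hE hS) inferInstance
  have : Surjective (schemeMap sP) := MorphismProperty.of_isPullback_of_descendsAlong
    (P := @Surjective) (Q := AlgebraicGeometry.fpqc) sq (h.fpqc hE hS) inferInstance
  refine ⟨P', p, sP, hS.of_schemeMap sP, sq', .mk' hσp fun z hz => ?_, inferInstance, inferInstance⟩
  obtain ⟨a, ha⟩ := h.exists_lift (z ≫ ρ) (by rw [Category.assoc, sq'.w, reassoc_of% hz, zero_comp])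
  exact ⟨a, sq'.hom_ext (by simp [hσ, ha]) (by simp [hσp, hz])⟩

/-! ### Exactness from kernels and orders -/

section Order

variable {K : CommGroupScheme O} {i : K ⟶ A} {f : A ⟶ B}

/-- A pair `(x, y)` with `f x = f y` is the same as `x` together with `y - x` in the kernel. -/
theorem isPullback_of_kernel [Mono i] (w : i ≫ f = 0)
    (h : ∀ {Z : CommGroupScheme O} (z : Z ⟶ A), z ≫ f = 0 → ∃ a, a ≫ i = z) :
    IsPullback (biprod.fst : A ⊞ K ⟶ A) (biprod.fst + biprod.snd ≫ i) f f := by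
  have key (s : PullbackCone f f) : ∃ k, k ≫ i = s.snd - s.fst :=
    h _ (by rw [Preadditive.sub_comp, s.condition, sub_self])
  choose k hk using key
  refine ⟨⟨by simp [Preadditive.add_comp, w]⟩, ⟨PullbackCone.IsLimit.mk _
    (fun s => biprod.lift s.fst (k s)) (by simp) (by simp [Preadditive.comp_add, hk])
    fun s m h₁ h₂ => biprod.hom_ext _ _ (by simp [h₁]) ?_⟩⟩
  rw [biprod.lift_snd, ← cancel_mono i, hk, ← h₂, ← h₁]
  simp [Preadditive.comp_add]

theorem finrank_biprod_fst (hY : IsFiniteFlat Y) {d : ℕ} (hd : HasOrder Y d) :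
    IsFinite (schemeMap (biprod.fst : X ⊞ Y ⟶ X)) ∧ Flat (schemeMap (biprod.fst : X ⊞ Y ⟶ X)) ∧
      ∀ x, (schemeMap (biprod.fst : X ⊞ Y ⟶ X)).finrank x = d := by
  have := hY.finite
  have := hY.flat
  have sq := isPullback_biprod X Y
  refine ⟨MorphismProperty.of_isPullback sq inferInstance,
    MorphismProperty.of_isPullback sq inferInstance, fun x => ?_⟩
  rw [Scheme.Hom.finrank_of_isPullback _ _ _ _ sq, hd]

/-- The first projection of `A ×_B A ≅ A × K` has constant rank `d`, which with injectivity on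
functions makes `f` faithfully flat. -/
theorem isShortExact_of_injective [Mono i] (w : i ≫ f = 0)
    (h : ∀ {Z : CommGroupScheme O} (z : Z ⟶ A), z ≫ f = 0 → ∃ a, a ≫ i = z)
    (hK : IsFiniteFlat K) (hA : IsFiniteFlat A) (hB : IsFiniteFlat B) {d : ℕ} (hd : HasOrder K d)
    (hf : Function.Injective (schemeMap f).appTop.hom) : IsShortExact i f := by
  have := hA.isAffine
  have := hB.isAffine
  have := hA.isFinite_schemeMap hB f
  obtain ⟨_, _, hr⟩ := finrank_biprod_fst (X := A) hK hd
  obtain ⟨_, _⟩ := flat_and_surjective_of_isPullback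
    (isPullback_schemeMap (isPullback_of_kernel w h)) hr hf
  exact .mk' w h

theorem appTop_injective_of_hasOrder [IsDomain O] [IsNoetherianRing O] [Mono i] (w : i ≫ f = 0)
    (h : ∀ {Z : CommGroupScheme O} (z : Z ⟶ A), z ≫ f = 0 → ∃ a, a ≫ i = z)
    (hK : IsFiniteFlat K) (hA : IsFiniteFlat A) (hB : IsFiniteFlat B) {d m : ℕ} (hd0 : d ≠ 0)
    (hd : HasOrder K d) (hm : HasOrder B m) (hdm : HasOrder A (d * m)) :
    Function.Injective (schemeMap f).appTop.hom := by
  have := hA.isAffine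
  have := hB.isAffine
  have := hA.finite
  have := hA.flat
  have := hB.finite
  have := hB.flat
  obtain ⟨_, _, hr⟩ := finrank_biprod_fst (X := A) hK hd
  exact appTop_injective_of_isPullback (schemeMap_comp_structureMap f)
    (isPullback_schemeMap (isPullback_of_kernel w h)) hd0 hr hm hdm

theorem appTop_injective_of_fpqc (hf : fpqc (schemeMap f)) (hA : IsFiniteFlat A)
    (hB : IsFiniteFlat B) : Function.Injective (schemeMap f).appTop.hom := by
  have := hA.isAffine
  have := hB.isAffine
  obtain ⟨⟨_, _⟩, _⟩ := hf
  exact ((Flat.flat_and_surjective_iff_faithfullyFlat_of_isAffine (schemeMap f)).1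
    ⟨inferInstance, inferInstance⟩).injective

end Order

end CommGroupScheme

/-! ### Extensions inside a subcategory closed under subquotients -/

namespace CommGroupScheme

variable {O : Type u} [CommRing O] {A B D A' B' D' X Y Z : CommGroupScheme O}

/-- The standing closure properties of a full subcategory of finite flat group schemes. -/
structure IsSubquotientClosed (𝒞 : ObjectProperty (CommGroupScheme O)) : Prop where
  isFiniteFlat : ∀ {X}, 𝒞 X → IsFiniteFlat X
  prod : ∀ {X Y}, 𝒞 X → 𝒞 Y → 𝒞 (X ⨯ Y)
  sub : ∀ {X Y} (i : X ⟶ Y), IsClosedFlatSubgroup i → 𝒞 Y → 𝒞 X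
  quot : ∀ {X Y Z} (i : X ⟶ Y) (q : Y ⟶ Z), IsClosedFlatSubgroup i → IsFiniteFlat Z →
    IsShortExact i q → 𝒞 Y → 𝒞 Z

attribute [local instance] hasBinaryBiproducts

namespace IsSubquotientClosed

variable {𝒞 : ObjectProperty (CommGroupScheme O)}

theorem of_mono (h𝒞 : IsSubquotientClosed 𝒞) (hY : 𝒞 Y) (hX : IsFiniteFlat X) (i : X ⟶ Y)
    [Mono i] : 𝒞 X :=
  h𝒞.sub i (hX.isClosedFlatSubgroup (h𝒞.isFiniteFlat hY) i) hY

theorem biprod (h𝒞 : IsSubquotientClosed 𝒞) (hX : 𝒞 X) (hY : 𝒞 Y) : 𝒞 (X ⊞ Y) :=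
  h𝒞.of_mono (h𝒞.prod hX hY) ((h𝒞.isFiniteFlat hX).biprod (h𝒞.isFiniteFlat hY))
    (biprod.isoProd X Y).hom

/-- Pushing out an extension of `Q` by `X'` along `φ : X' ⟶ U`, one obtains an extension of `Q` by
the kernel `S` of `ψ : U ⟶ V` as soon as `φ ≫ ψ` extends to `X`. If all extensions of `Q` by `S`
admit maps to `U` extending the inclusion of `S`, then `φ` extends to `X`. -/
theorem exists_extension (h𝒞 : IsSubquotientClosed 𝒞) {X' Q S U V : CommGroupScheme O}
    {inc : X' ⟶ X} {π : X ⟶ Q} {κ : S ⟶ U}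
    {ψ : U ⟶ V} (h₁ : IsShortExact inc π) (h₂ : IsShortExact κ ψ) (hX' : 𝒞 X') (hX : 𝒞 X)
    (hQ : 𝒞 Q) (hU : 𝒞 U) (hV : 𝒞 V) {φ : X' ⟶ U} {g : X ⟶ V} (hg : inc ≫ g = φ ≫ ψ)
    (hS : ∀ {P : CommGroupScheme O} (κ' : S ⟶ P) (q : P ⟶ Q), 𝒞 P → IsShortExact κ' q →
      ∃ d : P ⟶ U, κ' ≫ d = κ) :
    ∃ f : X ⟶ U, inc ≫ f = φ := by
  have hX'f := h𝒞.isFiniteFlat hX'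
  have hXf := h𝒞.isFiniteFlat hX
  have hQf := h𝒞.isFiniteFlat hQ
  have hUf := h𝒞.isFiniteFlat hU
  have hVf := h𝒞.isFiniteFlat hV
  -- The extension of `Q` by `S` is `P' = (U ×_V X) / X'`, with `X'` embedded by `(φ, inc)`; as a
  -- subquotient of `U ⊞ X` it lies in `𝒞`.
  have sq := IsPullback.of_hasPullback ψ g
  set b := pullback.fst ψ g
  set ρ := pullback.snd ψ g
  have hP := h₂.isFiniteFlat_of_isPullback hUf hVf hXf sq
  have hSE := h₂.of_isPullback sq
  have := hSE.flat
  have := hSE.surjective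
  set ν := sq.lift κ 0 (by simp [h₂.comp_eq_zero]) with hν
  let σ := sq.lift φ inc hg.symm
  obtain ⟨P', p, s, hP', sq', hσp, _, _⟩ := h₁.exists_descent hX'f hXf hQf hP (ρ := ρ) (σ := σ)
    (sq.lift_snd _ _ _)
  have hνρ : ν ≫ ρ = 0 := sq.lift_snd _ _ _
  have : Mono (biprod.lift b ρ) := ⟨fun x y hxy => sq.hom_ext
    (by simpa using hxy =≫ biprod.fst) (by simpa using hxy =≫ biprod.snd)⟩
  have hPC : 𝒞 (pullback ψ g) := h𝒞.of_mono (h𝒞.biprod hU hX) hP (biprod.lift b ρ)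
  have := hσp.mono
  have hP'C : 𝒞 P' := h𝒞.quot σ p (hX'f.isClosedFlatSubgroup hP σ) hP' hσp hPC
  have hs : p ≫ s = ρ ≫ π := sq'.w.symm
  have := hSE.mono
  have : Mono (ν ≫ p) := ⟨fun x y hxy => by
    rw [← cancel_mono ν]
    refine sq'.hom_ext ?_ (by simpa using hxy)
    simp [hνρ]⟩
  have hνp : IsShortExact (ν ≫ p) s := .mk' (by simp [hs, reassoc_of% hνρ]) fun z hz => by
    obtain ⟨a, ha⟩ := hSE.exists_lift (sq'.lift 0 z (by simp [hz])) (sq'.lift_fst _ _ _)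
    exact ⟨a, by rw [← Category.assoc, ha, sq'.lift_snd]⟩
  obtain ⟨d, hd⟩ := hS _ _ hP'C hνp
  -- The projection to `U` and the map through `P'` agree on `S`, so their difference descends from
  -- `U ×_V X` to `X`. On `X'` the second map vanishes, which leaves `φ`.
  obtain ⟨f, hf⟩ := hSE.exists_desc hP hXf (b - p ≫ d) (by
    rw [Preadditive.comp_sub, sub_eq_zero, ← Category.assoc, hd, sq.lift_fst])
  refine ⟨f, ?_⟩
  have : σ ≫ ρ = inc := sq.lift_snd _ _ _
  rw [← this, Category.assoc, hf, Preadditive.comp_sub, sq.lift_fst,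
    reassoc_of% hσp.comp_eq_zero]
  simp

end IsSubquotientClosed

theorem surjective_structureMap (X : CommGroupScheme O) : Surjective X.structureMap := by
  let T : CommGroupScheme O := CommGrp.trivial _
  have h : schemeMap (0 : T ⟶ X) ≫ X.structureMap = T.structureMap := schemeMap_comp_structureMap _
  have hT : Surjective T.structureMap := inferInstanceAs (Surjective (𝟙 _))
  rw [← h] at hT
  exact .of_comp (schemeMap (0 : T ⟶ X)) X.structureMap

theorem isShortExact_biprod (hX : IsFiniteFlat X) :
    IsShortExact (biprod.inl : X ⟶ X ⊞ Y) (biprod.snd : X ⊞ Y ⟶ Y) := by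
  have sq := isPullback_biprod X Y
  have := hX.flat
  have := X.surjective_structureMap
  have : Flat (schemeMap (biprod.snd : X ⊞ Y ⟶ Y)) :=
    MorphismProperty.of_isPullback sq.flip inferInstance
  have : Surjective (schemeMap (biprod.snd : X ⊞ Y ⟶ Y)) :=
    MorphismProperty.of_isPullback sq.flip inferInstance
  exact .mk' (by simp) fun z hz => ⟨z ≫ biprod.fst, biprod.hom_ext _ _ (by simp) (by simp [hz])⟩

theorem IsSubquotientClosed.exists_retraction {𝒞 : ObjectProperty (CommGroupScheme O)}
    (h𝒞 : IsSubquotientClosed 𝒞) [Subsingleton (ExtIn 𝒞 A B)] (hA : 𝒞 A) (hB : 𝒞 B) {E}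
    (hE : 𝒞 E) {i : B ⟶ E} {q : E ⟶ A} (h : IsShortExact i q) : ∃ d : E ⟶ B, i ≫ d = 𝟙 B := by
  let E₁ : Extension 𝒞 A B := ⟨E, hE, i, q, h⟩
  let E₂ : Extension 𝒞 A B :=
    ⟨B ⊞ A, h𝒞.biprod hB hA, biprod.inl, biprod.snd, isShortExact_biprod (h𝒞.isFiniteFlat hB)⟩
  obtain ⟨φ, hφ, -⟩ := Quotient.exact
    (Subsingleton.elim (α := ExtIn 𝒞 A B) (Quotient.mk _ E₁) (Quotient.mk _ E₂))
  exact ⟨φ.hom ≫ biprod.fst, by rw [reassoc_of% hφ]; exact biprod.inl_fst⟩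

end CommGroupScheme

/-! ### Towers -/

/-- A sequence of group schemes `T n` with transition maps in both directions, such as the `ϖ ^ n`
torsion of a `p`-divisible group with the inclusions and multiplication by `ϖ`. -/
structure CommGroupScheme.Tower (O : Type u) [CommRing O] where
  obj : ℕ → CommGroupScheme O
  incl (n : ℕ) : obj n ⟶ obj (n + 1)
  proj (n : ℕ) : obj (n + 1) ⟶ obj n

namespace CommGroupScheme.Tower

variable {O : Type u} [CommRing O] (t : Tower O)

/-- The composite of the inclusions from `T 1` to `T (n + 1)`. -/
noncomputable def fromOne : (n : ℕ) → (t.obj 1 ⟶ t.obj (n + 1))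
  | 0 => 𝟙 _
  | n + 1 => fromOne n ≫ t.incl (n + 1)

/-- The composite of the projections from `T (n + 1)` to `T 1`. -/
noncomputable def toOne : (n : ℕ) → (t.obj (n + 1) ⟶ t.obj 1)
  | 0 => 𝟙 _
  | n + 1 => t.proj (n + 1) ≫ toOne n

@[simp] theorem fromOne_zero : t.fromOne 0 = 𝟙 _ := rfl
@[simp] theorem toOne_zero : t.toOne 0 = 𝟙 _ := rfl
theorem fromOne_succ (n : ℕ) : t.fromOne (n + 1) = t.fromOne n ≫ t.incl (n + 1) := rfl
theorem toOne_succ (n : ℕ) : t.toOne (n + 1) = t.proj (n + 1) ≫ t.toOne n := rfl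

/-- A tower behaves like the `ϖ ^ n` torsion of a `p`-divisible group. -/
structure IsExact : Prop where
  isZero : IsZero (t.obj 0)
  comm (n : ℕ) : t.incl (n + 1) ≫ t.proj (n + 1) = t.proj n ≫ t.incl n
  isShortExact_proj (n : ℕ) : IsShortExact (t.fromOne n) (t.proj n)
  isShortExact_incl (n : ℕ) : IsShortExact (t.incl n) (t.toOne n)

end CommGroupScheme.Tower

/-! ### The tower of `ϖ`-power torsion in a `p`-divisible group -/

namespace PDivisibleGroup

variable {p : ℕ} {O : Type u} [CommRing O] (G : PDivisibleGroup p O)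

instance incl_mono (n : ℕ) : Mono (G.incl n) :=
  ⟨fun _ _ h => Fork.IsLimit.hom_ext (G.isKernel n).some h⟩

theorem exists_lift_incl {Z : CommGroupScheme O} {n : ℕ} (z : Z ⟶ G.level (n + 1))
    (hz : (p ^ n : ℕ) • z = 0) : ∃ a, a ≫ G.incl n = z := by
  have h : z ≫ ((p ^ n : ℕ) • 𝟙 (G.level (n + 1))) = 0 := by
    rw [Preadditive.comp_nsmul, Category.comp_id, hz]
  exact ⟨(G.isKernel n).some.lift (KernelFork.ofι z h),
    (G.isKernel n).some.fac (KernelFork.ofι z h) .zero⟩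

theorem pow_smul_eq_zero {Z : CommGroupScheme O} {n : ℕ} (z : Z ⟶ G.level n) :
    (p ^ n : ℕ) • z = 0 := by
  have h := G.incl_pow n
  rw [Preadditive.comp_nsmul, Category.comp_id] at h
  rw [← cancel_mono (G.incl n), Preadditive.nsmul_comp, ← Preadditive.comp_nsmul, h, comp_zero,
    zero_comp]

/-- The composite of the inclusions from level `1` to level `n + 1`. -/
noncomputable def inclFromOne : (n : ℕ) → (G.level 1 ⟶ G.level (n + 1))
  | 0 => 𝟙 _
  | n + 1 => inclFromOne n ≫ G.incl (n + 1)

instance inclFromOne_mono : (n : ℕ) → Mono (G.inclFromOne n)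
  | 0 => inferInstanceAs (Mono (𝟙 _))
  | n + 1 =>
    have := inclFromOne_mono n
    inferInstanceAs (Mono (G.inclFromOne n ≫ G.incl (n + 1)))

theorem exists_lift_inclFromOne {Z : CommGroupScheme O} :
    ∀ {n : ℕ} (z : Z ⟶ G.level (n + 1)), p • z = 0 → ∃ a, a ≫ G.inclFromOne n = z
  | 0, z, _ => ⟨z, Category.comp_id _⟩
  | n + 1, z, hz => by
    obtain ⟨b, rfl⟩ := G.exists_lift_incl z (by rw [pow_succ, mul_smul, hz, smul_zero])
    rw [← Preadditive.nsmul_comp] at hz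
    replace hz := zero_of_comp_mono _ hz
    obtain ⟨a, rfl⟩ := exists_lift_inclFromOne b hz
    exact ⟨a, (Category.assoc _ _ _).symm⟩

theorem exists_mul (n : ℕ) : ∃ m : G.level (n + 1) ⟶ G.level n, m ≫ G.incl n = p • 𝟙 _ :=
  G.exists_lift_incl _ (by rw [← mul_smul, ← pow_succ, pow_smul_eq_zero])

/-- Multiplication by `p`, as a map from level `n + 1` to level `n`. -/
noncomputable def mul (n : ℕ) : G.level (n + 1) ⟶ G.level n := (G.exists_mul n).choose

theorem mul_incl (n : ℕ) : G.mul n ≫ G.incl n = p • 𝟙 _ := (G.exists_mul n).choose_spec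

/-- The kernel of `p` on level `n + 1` is level `1`, and the orders satisfy `p ^ ((n + 1) * h) = p ^
h * p ^ (n * h)`, so the degree criterion for injectivity on functions applies. -/
theorem isShortExact_mul [IsDomain O] [IsNoetherianRing O] (hp : p.Prime) (n : ℕ) :
    IsShortExact (G.inclFromOne n) (G.mul n) := by
  have w : G.inclFromOne n ≫ G.mul n = 0 := by
    rw [← cancel_mono (G.incl n), Category.assoc, mul_incl, zero_comp, Preadditive.comp_nsmul,
      Category.comp_id]
    have := G.pow_smul_eq_zero (𝟙 (G.level 1))
    rw [pow_one] at this
    rw [← Category.id_comp (G.inclFromOne n), ← Preadditive.nsmul_comp, this, zero_comp]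
  have h {Z : CommGroupScheme O} (z : Z ⟶ G.level (n + 1)) (hz : z ≫ G.mul n = 0) :
      ∃ a, a ≫ G.inclFromOne n = z := by
    refine G.exists_lift_inclFromOne z ?_
    have := hz =≫ G.incl n
    rwa [Category.assoc, mul_incl, zero_comp, Preadditive.comp_nsmul, Category.comp_id] at this
  have h1 := G.hasOrder 1
  rw [one_mul] at h1
  have hn := G.hasOrder (n + 1)
  rw [add_mul, pow_add, one_mul, mul_comm] at hn
  exact isShortExact_of_injective w h (G.isFiniteFlat 1) (G.isFiniteFlat _) (G.isFiniteFlat _) h1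
    (appTop_injective_of_hasOrder w h (G.isFiniteFlat 1) (G.isFiniteFlat _) (G.isFiniteFlat _)
      (pow_ne_zero _ hp.ne_zero) h1 (G.hasOrder n) hn)

variable {G} {R : Type w} [CommRing R] (e : R ≃+* End G) (ϖ : R)

theorem app_mul (r s : R) (n : ℕ) : app (e (r * s)) n = app (e r) n ≫ app (e s) n := by
  rw [mul_comm, map_mul, End.mul_def, comp_app]

theorem app_natCast (m n : ℕ) : app (e (m : R)) n = m • 𝟙 (G.level n) := by
  rw [map_natCast]
  induction m with
  | zero => rw [Nat.cast_zero, zero_app, zero_smul]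
  | succ m ih => rw [Nat.cast_succ, add_app, ih, add_smul, one_smul, End.one_def, id_app]

theorem torsionIncl_app_pow (n : ℕ) : G.torsionIncl (e ϖ) n ≫ app (e (ϖ ^ n)) n = 0 := by
  rw [map_pow]
  exact torsionIncl_comp G (e ϖ) n

theorem exists_lift_torsionIncl {Z : CommGroupScheme O} {n : ℕ} (z : Z ⟶ G.level n)
    (hz : z ≫ app (e (ϖ ^ n)) n = 0) : ∃ a, a ≫ G.torsionIncl (e ϖ) n = z := by
  rw [map_pow] at hz
  exact ⟨kernel.lift _ z hz, kernel.lift_ι _ _ _⟩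

theorem torsionSucc_torsionIncl (n : ℕ) : G.torsionSucc (e ϖ) n ≫ G.torsionIncl (e ϖ) (n + 1) =
    G.torsionIncl (e ϖ) n ≫ G.incl n := kernel.lift_ι _ _ _

instance torsionSucc_mono (n : ℕ) : Mono (G.torsionSucc (e ϖ) n) :=
  have : Mono (G.torsionSucc (e ϖ) n ≫ G.torsionIncl (e ϖ) (n + 1)) := by
    rw [torsionSucc_torsionIncl]
    exact mono_comp _ _
  mono_of_mono _ (G.torsionIncl (e ϖ) (n + 1))

theorem torsionSucc_torsionMap (n : ℕ) (r : R) : G.torsionSucc (e ϖ) n ≫ torsionMap e ϖ (n + 1) r =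
    torsionMap e ϖ n r ≫ G.torsionSucc (e ϖ) n := by
  rw [← cancel_mono (G.torsionIncl (e ϖ) (n + 1)), Category.assoc, Category.assoc, torsionMap_incl,
    torsionSucc_torsionIncl, reassoc_of% torsionSucc_torsionIncl, incl_app,
    reassoc_of% torsionMap_incl]

theorem torsionMap_mul (n : ℕ) (r s : R) :
    torsionMap e ϖ n (r * s) = torsionMap e ϖ n r ≫ torsionMap e ϖ n s := by
  rw [← cancel_mono (G.torsionIncl (e ϖ) n), Category.assoc, torsionMap_incl, torsionMap_incl,
    reassoc_of% torsionMap_incl, app_mul]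

theorem torsionMap_pow_self (n : ℕ) : torsionMap e ϖ n (ϖ ^ n) = 0 := by
  rw [← cancel_mono (G.torsionIncl (e ϖ) n), torsionMap_incl, torsionIncl_app_pow, zero_comp]

variable {e ϖ}

/-- A point killed by `ϖ ^ n` is killed by `p ^ n`, since `ϖ` divides `p`, and therefore already
lies in level `n`. This makes the levelwise definition of torsion agree across levels. -/
theorem exists_lift_torsionSucc (hdvd : ϖ ∣ (p : R)) {Z : CommGroupScheme O} {n : ℕ}
    (z : Z ⟶ G.torsion (e ϖ) (n + 1)) (hz : z ≫ torsionMap e ϖ (n + 1) (ϖ ^ n) = 0) :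
    ∃ a, a ≫ G.torsionSucc (e ϖ) n = z := by
  obtain ⟨c, hc⟩ := pow_dvd_pow_of_dvd hdvd n
  have hz' : z ≫ G.torsionIncl (e ϖ) (n + 1) ≫ app (e (ϖ ^ n)) (n + 1) = 0 := by
    rw [← torsionMap_incl, reassoc_of% hz, zero_comp]
  obtain ⟨b, hb⟩ := G.exists_lift_incl (z ≫ G.torsionIncl (e ϖ) (n + 1)) (by
    have := app_natCast e (p ^ n) (n + 1)
    rw [Nat.cast_pow, hc, app_mul] at this
    have h := (z ≫ G.torsionIncl (e ϖ) (n + 1)) ≫= this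
    rw [Preadditive.comp_nsmul, Category.comp_id] at h
    rw [← h, Category.assoc, reassoc_of% hz', zero_comp])
  obtain ⟨a, rfl⟩ := exists_lift_torsionIncl e ϖ b (by
    rw [← cancel_mono (G.incl n), Category.assoc, ← incl_app, reassoc_of% hb, hz', zero_comp])
  exact ⟨a, by rw [← cancel_mono (G.torsionIncl (e ϖ) (n + 1)), Category.assoc,
    torsionSucc_torsionIncl, ← Category.assoc, hb]⟩

theorem exists_torsionProj (hdvd : ϖ ∣ (p : R)) (n : ℕ) :
    ∃ ψ, ψ ≫ G.torsionSucc (e ϖ) n = torsionMap e ϖ (n + 1) ϖ :=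
  exists_lift_torsionSucc hdvd _ (by rw [← torsionMap_mul, ← pow_succ', torsionMap_pow_self])

/-- Multiplication by `ϖ`, as a map from `G[ϖⁿ⁺¹]` to `G[ϖⁿ]`. -/
noncomputable def torsionProj (hdvd : ϖ ∣ (p : R)) (n : ℕ) :
    G.torsion (e ϖ) (n + 1) ⟶ G.torsion (e ϖ) n := (exists_torsionProj hdvd n).choose

theorem torsionProj_torsionSucc (hdvd : ϖ ∣ (p : R)) (n : ℕ) :
    torsionProj hdvd n ≫ G.torsionSucc (e ϖ) n = torsionMap e ϖ (n + 1) ϖ :=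
  (exists_torsionProj hdvd n).choose_spec

theorem torsionSucc_torsionProj (hdvd : ϖ ∣ (p : R)) (n : ℕ) :
    G.torsionSucc (e ϖ) n ≫ torsionProj hdvd n = torsionMap e ϖ n ϖ := by
  rw [← cancel_mono (G.torsionSucc (e ϖ) n), Category.assoc, torsionProj_torsionSucc,
    torsionSucc_torsionMap]

theorem torsionMap_torsionProj (hdvd : ϖ ∣ (p : R)) (n : ℕ) (r : R) :
    torsionMap e ϖ (n + 1) r ≫ torsionProj hdvd n = torsionProj hdvd n ≫ torsionMap e ϖ n r := by
  rw [← cancel_mono (G.torsionSucc (e ϖ) n), Category.assoc, Category.assoc,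
    torsionProj_torsionSucc, ← torsionSucc_torsionMap, reassoc_of% torsionProj_torsionSucc,
    ← torsionMap_mul, ← torsionMap_mul, mul_comm]

/-- The tower of the `G[ϖⁿ]`. -/
noncomputable abbrev torsionTower (hdvd : ϖ ∣ (p : R)) : Tower O where
  obj n := G.torsion (e ϖ) n
  incl n := G.torsionSucc (e ϖ) n
  proj n := torsionProj hdvd n

theorem exists_lift_fromOne (hdvd : ϖ ∣ (p : R)) {Z : CommGroupScheme O} :
    ∀ {n : ℕ} (z : Z ⟶ G.torsion (e ϖ) (n + 1)), z ≫ torsionMap e ϖ (n + 1) ϖ = 0 →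
      ∃ a, a ≫ (torsionTower hdvd).fromOne n = z
  | 0, z, _ => ⟨z, Category.comp_id _⟩
  | n + 1, z, hz => by
    obtain ⟨b, rfl⟩ := exists_lift_torsionSucc hdvd z (by
      rw [pow_succ', torsionMap_mul, reassoc_of% hz, zero_comp])
    rw [Category.assoc, torsionSucc_torsionMap, ← Category.assoc] at hz
    replace hz := zero_of_comp_mono _ hz
    obtain ⟨a, rfl⟩ := exists_lift_fromOne hdvd b hz
    exact ⟨a, (Category.assoc _ _ _).symm⟩

theorem fromOne_torsionMap (hdvd : ϖ ∣ (p : R)) (r : R) : ∀ n : ℕ,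
    (torsionTower (e := e) hdvd).fromOne n ≫ torsionMap e ϖ (n + 1) r =
      torsionMap e ϖ 1 r ≫ (torsionTower hdvd).fromOne n
  | 0 => (Category.id_comp _).trans (Category.comp_id _).symm
  | n + 1 => by
    have h := fromOne_torsionMap hdvd r n
    have h' : (torsionTower (e := e) hdvd).incl (n + 1) ≫ torsionMap e ϖ (n + 2) r =
      torsionMap e ϖ (n + 1) r ≫ (torsionTower (e := e) hdvd).incl (n + 1) :=
        torsionSucc_torsionMap e ϖ (n + 1) r
    rw [Tower.fromOne_succ, Category.assoc, h', reassoc_of% h]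

instance fromOne_mono (hdvd : ϖ ∣ (p : R)) :
    ∀ n : ℕ, Mono ((torsionTower (e := e) hdvd).fromOne n)
  | 0 => inferInstanceAs (Mono (𝟙 _))
  | n + 1 =>
    have := fromOne_mono hdvd n
    have : Mono ((torsionTower (e := e) hdvd).incl (n + 1)) := torsionSucc_mono e ϖ (n + 1)
    inferInstanceAs (Mono ((torsionTower hdvd).fromOne n ≫ (torsionTower hdvd).incl (n + 1)))

theorem toOne_fromOne (hdvd : ϖ ∣ (p : R)) : ∀ n : ℕ,
    (torsionTower (e := e) hdvd).toOne n ≫ (torsionTower hdvd).fromOne n =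
      torsionMap e ϖ (n + 1) (ϖ ^ n)
  | 0 => by
    rw [pow_zero]
    exact (Category.comp_id _).trans (map_one (torsionAction e ϖ 1)).symm
  | n + 1 => by
    have h := toOne_fromOne hdvd n
    rw [Tower.toOne_succ, Tower.fromOne_succ, Category.assoc, reassoc_of% h]
    change torsionProj hdvd (n + 1) ≫ _ ≫ G.torsionSucc (e ϖ) (n + 1) = _
    rw [← torsionSucc_torsionMap, reassoc_of% torsionProj_torsionSucc, ← torsionMap_mul, pow_succ']

/-- No order count for the torsion is needed. The pullback of `p : G (n + 1) → G n` to the `ϖ ^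
n`-torsion is faithfully flat, and writing `p = ϖ * c` it factors through multiplication by `ϖ`; an
injective composite on functions forces its first factor to be injective. -/
theorem appTop_injective_torsionProj [IsDomain O] [IsNoetherianRing O] (hp : p.Prime)
    (hdvd : ϖ ∣ (p : R))
    {n : ℕ} (h₂ : IsFiniteFlat (G.torsion (e ϖ) n)) :
    Function.Injective (schemeMap (torsionProj (e := e) hdvd n)).appTop.hom := by
  obtain ⟨c, hc⟩ := hdvd
  have sq := IsPullback.of_hasPullback (G.mul n) (G.torsionIncl (e ϖ) n)
  set x := pullback.fst (G.mul n) (G.torsionIncl (e ϖ) n)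
  set y := pullback.snd (G.mul n) (G.torsionIncl (e ϖ) n)
  have hSE := G.isShortExact_mul hp n
  have hE := hSE.isFiniteFlat_of_isPullback (G.isFiniteFlat _) (G.isFiniteFlat _) h₂ sq
  have hy := appTop_injective_of_fpqc ((hSE.of_isPullback sq).fpqc hE h₂) hE h₂
  have hxp : x ≫ app (e (p : R)) (n + 1) = y ≫ G.torsionIncl (e ϖ) n ≫ G.incl n := by
    rw [app_natCast, ← mul_incl, sq.w_assoc]
  -- The point `c x` is killed by `ϖ ^ (n + 1)`, because `ϖ ^ (n + 1) * c * x = ϖ ^ n * (p * x)` and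
  -- `p x` is `ϖ ^ n`-torsion.
  obtain ⟨w, hw⟩ := exists_lift_torsionIncl e ϖ (x ≫ app (e c) (n + 1)) (by
    rw [Category.assoc, ← app_mul, pow_succ', ← mul_assoc, mul_comm c, ← hc, app_mul,
      reassoc_of% hxp, incl_app, reassoc_of% torsionIncl_app_pow]
    simp)
  have hwy : w ≫ torsionProj ⟨c, hc⟩ n = y := by
    rw [← cancel_mono (G.torsionSucc (e ϖ) n), ← cancel_mono (G.torsionIncl (e ϖ) (n + 1)),
      Category.assoc, Category.assoc, Category.assoc, reassoc_of% torsionProj_torsionSucc,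
      torsionMap_incl, reassoc_of% hw, ← app_mul, mul_comm c, ← hc, hxp, torsionSucc_torsionIncl]
  have hwy' : schemeMap w ≫ schemeMap (torsionProj ⟨c, hc⟩ n) = schemeMap y :=
    congrArg schemeMap hwy
  rw [← hwy', Scheme.Hom.comp_appTop, CommRingCat.hom_comp, RingHom.coe_comp] at hy
  exact hy.of_comp

theorem isShortExact_torsionProj [IsDomain O] [IsNoetherianRing O] (hp : p.Prime)
    (hdvd : ϖ ∣ (p : R))
    (h : ∀ n, IsFiniteFlat (G.torsion (e ϖ) n)) {d : ℕ} (hd : HasOrder (G.torsion (e ϖ) 1) d)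
    (n : ℕ) :
    IsShortExact ((torsionTower (e := e) hdvd).fromOne n) (torsionProj hdvd n) := by
  have w : (torsionTower (e := e) hdvd).fromOne n ≫ (torsionTower hdvd).proj n = 0 := by
    rw [← cancel_mono (G.torsionSucc (e ϖ) n), Category.assoc, torsionProj_torsionSucc,
      fromOne_torsionMap]
    have := torsionMap_pow_self e ϖ 1
    rw [pow_one] at this
    rw [this, zero_comp, zero_comp]
  have hl {Z : CommGroupScheme O} (z : Z ⟶ G.torsion (e ϖ) (n + 1))
      (hz : z ≫ torsionProj hdvd n = 0) : ∃ a, a ≫ (torsionTower hdvd).fromOne n = z :=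
    exists_lift_fromOne hdvd z (by
      rw [← torsionProj_torsionSucc hdvd, reassoc_of% hz, zero_comp])
  exact isShortExact_of_injective w hl (h 1) (h (n + 1)) (h n) hd
    (appTop_injective_torsionProj hp hdvd (h n))
theorem fpqc_toOne [IsDomain O] [IsNoetherianRing O] (hp : p.Prime) (hdvd : ϖ ∣ (p : R))
    (h : ∀ n, IsFiniteFlat (G.torsion (e ϖ) n)) {d : ℕ} (hd : HasOrder (G.torsion (e ϖ) 1) d) :
    ∀ n : ℕ, fpqc (schemeMap ((torsionTower (e := e) hdvd).toOne n))
  | 0 => ⟨⟨inferInstanceAs (Surjective (𝟙 _)), inferInstanceAs (Flat (𝟙 _))⟩,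
      inferInstanceAs (QuasiCompact (𝟙 _))⟩
  | n + 1 => MorphismProperty.comp_mem fpqc _ _
      ((isShortExact_torsionProj hp hdvd h hd (n + 1)).fpqc (h _) (h _))
      (fpqc_toOne hp hdvd h hd n)

theorem isExact_torsionTower [IsDomain O] [IsNoetherianRing O] (hp : p.Prime) (hdvd : ϖ ∣ (p : R))
    (h : ∀ n, IsFiniteFlat (G.torsion (e ϖ) n)) {d : ℕ} (hd : HasOrder (G.torsion (e ϖ) 1) d) :
    (torsionTower (e := e) hdvd).IsExact where
  isZero := by
    rw [IsZero.iff_id_eq_zero, ← cancel_mono (G.torsionIncl (e ϖ) 0), Category.id_comp, zero_comp]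
    simpa using G.pow_smul_eq_zero (G.torsionIncl (e ϖ) 0)
  comm n := by
    change G.torsionSucc (e ϖ) (n + 1) ≫ torsionProj hdvd (n + 1) = torsionProj hdvd n ≫ _
    exact (torsionSucc_torsionProj hdvd _).trans (torsionProj_torsionSucc hdvd _).symm
  isShortExact_proj := isShortExact_torsionProj hp hdvd h hd
  isShortExact_incl n := by
    have w : (torsionTower (e := e) hdvd).incl n ≫ (torsionTower hdvd).toOne n = 0 := by
      rw [← cancel_mono ((torsionTower hdvd).fromOne n), Category.assoc, toOne_fromOne,
        torsionSucc_torsionMap, torsionMap_pow_self, zero_comp, zero_comp]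
    obtain ⟨⟨_, _⟩, _⟩ := fpqc_toOne hp hdvd h hd n
    exact .mk' w fun z hz => exists_lift_torsionSucc hdvd z (by
      rw [← toOne_fromOne hdvd, reassoc_of% hz, zero_comp])

end PDivisibleGroup

/-! ### Splitting and shearing biproducts -/

namespace CategoryTheory.Limits

variable {C : Type u} [Category.{v} C] [Preadditive C] [HasBinaryBiproducts C]

/-- Splitting off one summand of a finite biproduct. -/
theorem biproduct.exists_iso_biprod [HasFiniteBiproducts C] {J K : Type*} [Finite J] [Finite K]
    (F : J → C) (x : J)
    (y : K → J) (hy : Function.Injective y) (hx : ∀ k, y k ≠ x) (hs : ∀ j, j ≠ x → ∃ k, y k = j) :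
    ∃ φ : (⨁ F) ≅ F x ⊞ ⨁ fun k => F (y k),
      φ.hom = biprod.lift (biproduct.π F x) (biproduct.lift fun k => biproduct.π F (y k)) := by
  refine ⟨⟨biprod.lift (biproduct.π F x) (biproduct.lift fun k => biproduct.π F (y k)),
    biprod.desc (biproduct.ι F x) (biproduct.desc fun k => biproduct.ι F (y k)), ?_, ?_⟩,
    rfl⟩
  · refine biproduct.hom_ext' _ _ fun j => ?_
    rw [Category.comp_id]
    by_cases hj : j = x
    · subst hj
      have : biproduct.ι F j ≫ biprod.lift (biproduct.π F j)
          (biproduct.lift fun k => biproduct.π F (y k)) = biprod.inl := by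
        apply biprod.hom_ext
        · simp
        · rw [Category.assoc, biprod.lift_snd, biprod.inl_snd]
          ext1 k
          simp [biproduct.ι_π_ne _ (hx k).symm]
      rw [reassoc_of% this, biprod.inl_desc]
    · obtain ⟨k, rfl⟩ := hs j hj
      have : biproduct.ι F (y k) ≫ biprod.lift (biproduct.π F x)
          (biproduct.lift fun k => biproduct.π F (y k)) =
            biproduct.ι (fun k => F (y k)) k ≫ biprod.inr := by
        apply biprod.hom_ext
        · simp [biproduct.ι_π_ne _ hj]
        · rw [Category.assoc, biprod.lift_snd, Category.assoc, biprod.inr_snd, Category.comp_id]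
          ext1 l
          rw [Category.assoc, biproduct.lift_π]
          by_cases h : k = l
          · subst h
            simp
          · rw [biproduct.ι_π_ne _ (hy.ne h), biproduct.ι_π_ne _ h]
      rw [reassoc_of% this, biprod.inr_desc, biproduct.ι_desc]
  · apply biprod.hom_ext'
    · rw [biprod.inl_desc_assoc, Category.comp_id]
      apply biprod.hom_ext
      · simp
      · rw [Category.assoc, biprod.lift_snd, biprod.inl_snd]
        ext1 k
        simp [biproduct.ι_π_ne _ (hx k).symm]
    · rw [biprod.inr_desc_assoc, Category.comp_id]
      ext1 k
      rw [biproduct.ι_desc_assoc]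
      apply biprod.hom_ext
      · simp [biproduct.ι_π_ne _ (hx k)]
      · rw [Category.assoc, biprod.lift_snd, Category.assoc, biprod.inr_snd, Category.comp_id]
        ext1 l
        rw [Category.assoc, biproduct.lift_π]
        by_cases h : k = l
        · subst h
          simp
        · rw [biproduct.ι_π_ne _ (hy.ne h), biproduct.ι_π_ne _ h]

/-- The shear `(a, b) ↦ (a, b - c a)` is an automorphism. It allows one coordinate to be subtracted
from the others without losing the decomposition. -/
theorem biprod.isIso_lift_sub {A B X : C} (u : X ⟶ A) (v : X ⟶ B) (c : A ⟶ B)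
    [IsIso (biprod.lift u v)] : IsIso (biprod.lift u (v - u ≫ c)) := by
  let s : A ⊞ B ≅ A ⊞ B :=
    { hom := biprod.lift biprod.fst (biprod.snd - biprod.fst ≫ c)
      inv := biprod.lift biprod.fst (biprod.snd + biprod.fst ≫ c)
      hom_inv_id := by apply biprod.hom_ext <;> simp [Preadditive.comp_add]
      inv_hom_id := by apply biprod.hom_ext <;> simp [Preadditive.comp_sub] }
  have : biprod.lift u (v - u ≫ c) = biprod.lift u v ≫ s.hom := by
    apply biprod.hom_ext <;> simp [Preadditive.comp_sub, s]
  rw [this]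
  exact IsIso.comp_isIso' inferInstance s.isIso_hom

end CategoryTheory.Limits

/-! ### Endomorphisms and direct sums of towers -/

namespace CommGroupScheme

variable {O : Type u} [CommRing O]

namespace Tower

/-- An endomorphism of a tower. -/
structure Endo (t : Tower O) where
  app (n : ℕ) : t.obj n ⟶ t.obj n
  incl_app (n : ℕ) : t.incl n ≫ app (n + 1) = app n ≫ t.incl n
  app_proj (n : ℕ) : app (n + 1) ≫ t.proj n = t.proj n ≫ app n

variable {t : Tower O}

theorem Endo.app_toOne (c : t.Endo) :
    ∀ n : ℕ, c.app (n + 1) ≫ t.toOne n = t.toOne n ≫ c.app 1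
  | 0 => (Category.comp_id _).trans (Category.id_comp _).symm
  | n + 1 => by
    rw [toOne_succ, ← Category.assoc, c.app_proj, Category.assoc, app_toOne c n, Category.assoc]

/-- A Schur-type argument: transitivity on nonzero maps gives `f` a one-sided inverse `c`, and then
gives `c` one as well, so the two are mutually inverse. -/
theorem isIso_of_ne_zero
    (hend : ∀ f₀ f : t.obj 1 ⟶ t.obj 1, f₀ ≠ 0 → ∃ c : t.Endo, f₀ ≫ c.app 1 = f)
    {f : t.obj 1 ⟶ t.obj 1} (hf : f ≠ 0) : IsIso f := by
  obtain ⟨c, hc⟩ := hend f (𝟙 _) hf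
  have hc0 : c.app 1 ≠ 0 := by
    intro h
    rw [h, comp_zero] at hc
    exact hf (by rw [← Category.comp_id f, ← hc, comp_zero])
  obtain ⟨d, hd⟩ := hend (c.app 1) (𝟙 _) hc0
  have : f = d.app 1 := by
    rw [← Category.comp_id f, ← hd, reassoc_of% hc]
  exact ⟨c.app 1, hc, by rw [this, hd]⟩

/-- Iterated multiplication by `ϖ` goes down from level `n` to level `m` compatibly with the
inclusions and inducing the identity on the top quotient. -/
theorem IsExact.exists_proj (ht : t.IsExact) {m n : ℕ} (hmn : m ≤ n) :
    ∃ (a : t.obj n ⟶ t.obj m) (b : t.obj (n + 1) ⟶ t.obj (m + 1)),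
      t.incl n ≫ b = a ≫ t.incl m ∧ b ≫ t.toOne m = t.toOne n := by
  induction n, hmn using Nat.le_induction with
  | base => exact ⟨𝟙 _, 𝟙 _, by simp, by simp⟩
  | succ n hmn ih =>
    obtain ⟨a, b, h₁, h₂⟩ := ih
    refine ⟨t.proj n ≫ a, t.proj (n + 1) ≫ b, ?_, ?_⟩
    · rw [← Category.assoc, ht.comm, Category.assoc, h₁, Category.assoc]
    · rw [Category.assoc, h₂, toOne_succ]

end Tower

attribute [local instance] hasBinaryBiproducts

theorem IsFiniteFlat.isShortExact_biprod_map {A B D W : CommGroupScheme O} {i : A ⟶ B} {q : B ⟶ D}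
    (hW : IsFiniteFlat W) (h : IsShortExact i q) :
    IsShortExact (biprod.map i (𝟙 W)) (biprod.fst ≫ q) := by
  have := h.mono
  have := h.flat
  have := h.surjective
  have := hW.flat
  have := W.surjective_structureMap
  have sq := isPullback_biprod B W
  have : Flat (schemeMap (biprod.fst : B ⊞ W ⟶ B)) :=
    MorphismProperty.of_isPullback sq inferInstance
  have : Surjective (schemeMap (biprod.fst : B ⊞ W ⟶ B)) :=
    MorphismProperty.of_isPullback sq inferInstance
  have : Flat (schemeMap ((biprod.fst : B ⊞ W ⟶ B) ≫ q)) := by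
    rw [schemeMap_comp]; infer_instance
  have : Surjective (schemeMap ((biprod.fst : B ⊞ W ⟶ B) ≫ q)) := by
    rw [schemeMap_comp]; infer_instance
  have : Mono (biprod.map i (𝟙 W)) := ⟨fun x y hxy => by
    apply biprod.hom_ext
    · rw [← cancel_mono i]
      simpa using hxy =≫ biprod.fst
    · simpa using hxy =≫ biprod.snd⟩
  refine .mk' (by simp [h.comp_eq_zero]) fun z hz => ?_
  obtain ⟨a, ha⟩ := h.exists_lift (z ≫ biprod.fst) (by rwa [Category.assoc])
  exact ⟨biprod.lift a (z ≫ biprod.snd), biprod.hom_ext _ _ (by simp [ha]) (by simp)⟩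

/-- `X` is a finite direct sum of nonzero terms of the towers `t i`. -/
def IsSumOfTowers {I : Type w} (t : I → Tower O) (X : CommGroupScheme O) : Prop :=
  ∃ (J : Type) (_ : Finite J) (a : J → I) (n : J → ℕ), (∀ s, 1 ≤ n s) ∧
    Nonempty (X ≅ ⨁ fun s => (t (a s)).obj (n s))

namespace IsSumOfTowers

variable {I : Type w} {t : I → Tower O} {X : CommGroupScheme O}

theorem of_isZero (hX : IsZero X) : IsSumOfTowers t X := by
  refine ⟨Empty, inferInstance, Empty.elim, Empty.elim, fun s => s.elim, ⟨hX.iso ?_⟩⟩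
  rw [IsZero.iff_id_eq_zero]
  exact biproduct.hom_ext _ _ fun s => s.elim

theorem of_iso_biprod {K : Type} [Finite K] {a : K → I} {n : K → ℕ} (hn : ∀ s, 1 ≤ n s) (i : I)
    {m : ℕ} (hm : 1 ≤ m) (e : X ≅ (t i).obj m ⊞ ⨁ fun s => (t (a s)).obj (n s)) :
    IsSumOfTowers t X := by
  let a' : Option K → I := fun o => o.elim i a
  let n' : Option K → ℕ := fun o => o.elim m n
  obtain ⟨φ, -⟩ := biproduct.exists_iso_biprod (fun s => (t (a' s)).obj (n' s)) none some
    (Option.some_injective K) (fun _ => by simp) (fun j hj => by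
      cases j with
      | none => exact absurd rfl hj
      | some k => exact ⟨k, rfl⟩)
  refine ⟨Option K, inferInstance, a', n', fun s => ?_, ⟨e ≪≫ φ.symm⟩⟩
  cases s with
  | none => exact hm
  | some s => exact hn s

end IsSumOfTowers

end CommGroupScheme

namespace CommGroupScheme

attribute [local instance] hasBinaryBiproducts

theorem IsFiniteFlat.biproduct {O : Type u} [CommRing O] {J : Type} [hJ : Finite J]
    {F : J → CommGroupScheme O} (hF : ∀ s, IsFiniteFlat (F s)) : IsFiniteFlat (⨁ F) := by
  revert hJ F
  refine Finite.induction_empty_option (P := fun J => ∀ [Finite J] {F : J → CommGroupScheme O},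
    (∀ s, IsFiniteFlat (F s)) → IsFiniteFlat (⨁ F)) ?_ ?_ ?_ J
  · intro J K e ih _ F hF
    have := Finite.of_equiv K e.symm
    exact (ih fun s => hF (e s)).of_iso (biproduct.reindex e F).symm
  · intro _ F _
    let T : CommGroupScheme O := CommGrp.trivial _
    have hT : IsFiniteFlat T := ⟨inferInstanceAs (IsFinite (𝟙 _)), inferInstanceAs (Flat (𝟙 _))⟩
    have h₁ : IsZero (⨁ F) := by
      rw [IsZero.iff_id_eq_zero]
      exact biproduct.hom_ext _ _ fun s => s.elim
    have h₂ : IsZero T := by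
      rw [IsZero.iff_id_eq_zero]
      exact CommGrp.hom_ext _ _ (toUnit_unique _ _)
    exact hT.of_iso (h₁.iso h₂)
  · intro K _ ih _ F hF
    obtain ⟨φ, -⟩ := biproduct.exists_iso_biprod F none some (Option.some_injective K)
      (fun _ => by simp) (fun j hj => by
        cases j with
        | none => exact absurd rfl hj
        | some k => exact ⟨k, rfl⟩)
    exact ((hF none).biprod (ih fun k => hF (some k))).of_iso φ

variable {O : Type u} [CommRing O] {I : Type w} {t : I → Tower O} {X : CommGroupScheme O}

/-! ### Orthogonal towers and the inductive step -/

/-- Exact towers in `𝒞` whose bottom terms have the smallest possible endomorphism rings and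
extension groups. -/
structure IsOrthogonal (𝒞 : ObjectProperty (CommGroupScheme O)) (t : I → Tower O) : Prop where
  isExact (i : I) : (t i).IsExact
  mem (i : I) (n : ℕ) : 𝒞 ((t i).obj n)
  exists_endo (i : I) (f₀ f : (t i).obj 1 ⟶ (t i).obj 1) : f₀ ≠ 0 →
    ∃ c : (t i).Endo, f₀ ≫ c.app 1 = f
  exists_extension (i : I) {E : CommGroupScheme O} (κ : (t i).obj 1 ⟶ E) (q : E ⟶ (t i).obj 1) :
    𝒞 E → IsShortExact κ q → ∃ h : E ⟶ (t i).obj 2, κ ≫ h = (t i).incl 1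
  exists_retraction {i j : I} : i ≠ j → ∀ {E : CommGroupScheme O} (κ : (t i).obj 1 ⟶ E)
    (q : E ⟶ (t j).obj 1), 𝒞 E → IsShortExact κ q → ∃ d : E ⟶ (t i).obj 1, κ ≫ d = 𝟙 _

namespace IsOrthogonal

variable {𝒞 : ObjectProperty (CommGroupScheme O)} {X' : CommGroupScheme O} {j : I} {inc : X' ⟶ X}
  {π : X ⟶ (t j).obj 1}

/-- Dévissage on `n`: the map to level `n` is extended first, and the obstruction to lifting it
through `proj` is an extension of `T j 1` by `T i 1`, which splits. -/
theorem exists_extension_of_ne (ht : IsOrthogonal 𝒞 t) (h𝒞 : IsSubquotientClosed 𝒞)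
    (h : IsShortExact inc π) (hX' : 𝒞 X') (hX : 𝒞 X) {i : I} (hij : i ≠ j) :
    ∀ {n : ℕ} (φ : X' ⟶ (t i).obj n), ∃ f : X ⟶ (t i).obj n, inc ≫ f = φ
  | 0, φ => ⟨0, (ht.isExact i).isZero.eq_of_tgt _ _⟩
  | n + 1, φ => by
    obtain ⟨g, hg⟩ := exists_extension_of_ne ht h𝒞 h hX' hX hij (φ ≫ (t i).proj n)
    refine h𝒞.exists_extension h ((ht.isExact i).isShortExact_proj n) hX' hX (ht.mem _ _)
      (ht.mem _ _) (ht.mem _ _) hg fun κ q hP hSE => ?_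
    obtain ⟨d, hd⟩ := ht.exists_retraction hij κ q hP hSE
    exact ⟨d ≫ (t i).fromOne n, by rw [reassoc_of% hd]⟩

/-- The same dévissage with `i = j`. The obstruction is now a self-extension of the bottom term; it
need not split, but it maps to `T 2`, hence to every higher level, which is why one extra step in
the target is enough. -/
theorem exists_extension_succ (ht : IsOrthogonal 𝒞 t) (h𝒞 : IsSubquotientClosed 𝒞)
    (h : IsShortExact inc π) (hX' : 𝒞 X') (hX : 𝒞 X) :
    ∀ {n : ℕ} (φ : X' ⟶ (t j).obj n), ∃ f : X ⟶ (t j).obj (n + 1), inc ≫ f = φ ≫ (t j).incl n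
  | 0, φ => ⟨0, by rw [(ht.isExact j).isZero.eq_of_tgt φ 0, comp_zero, zero_comp]⟩
  | n + 1, φ => by
    obtain ⟨g, hg⟩ := exists_extension_succ ht h𝒞 h hX' hX (φ ≫ (t j).proj n)
    refine h𝒞.exists_extension h ((ht.isExact j).isShortExact_proj (n + 1)) hX' hX (ht.mem _ _)
      (ht.mem _ _) (ht.mem _ _) (g := g) (by rw [hg, Category.assoc, Category.assoc,
        (ht.isExact j).comm]) fun κ q hP hSE => ?_
    obtain ⟨d, hd⟩ := ht.exists_extension j κ q hP hSE
    have key : ∀ m, ∃ a : (t j).obj 2 ⟶ (t j).obj (m + 2),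
        (t j).incl 1 ≫ a = (t j).fromOne (m + 1) := by
      intro m
      induction m with
      | zero => exact ⟨𝟙 _, (Category.comp_id _).trans (Category.id_comp _).symm⟩
      | succ m ih =>
        obtain ⟨a, ha⟩ := ih
        exact ⟨a ≫ (t j).incl (m + 2), by rw [reassoc_of% ha]; rfl⟩
    obtain ⟨a, ha⟩ := key n
    exact ⟨d ≫ a, by rw [reassoc_of% hd, ha]⟩

/-- Every map from `X'` to a term of one of the towers extends to `X` after moving up by one step,
and the obstruction to extending it without moving up lies in `Hom(T 1, T 1)`. -/
theorem exists_obstruction (ht : IsOrthogonal 𝒞 t) (h𝒞 : IsSubquotientClosed 𝒞)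
    (h : IsShortExact inc π) (hX' : 𝒞 X') (hX : 𝒞 X) {i : I} {n : ℕ} (φ : X' ⟶ (t i).obj n) :
    ∃ (f : X ⟶ (t i).obj (n + 1)) (g : (t j).obj 1 ⟶ (t i).obj 1),
      inc ≫ f = φ ≫ (t i).incl n ∧ π ≫ g = f ≫ (t i).toOne n ∧ (g ≠ 0 → i = j) := by
  have hSE := (ht.isExact i).isShortExact_incl n
  by_cases hij : i = j
  · subst hij
    obtain ⟨f, hf⟩ := exists_extension_succ ht h𝒞 h hX' hX φ
    obtain ⟨g, hg⟩ := h.exists_desc (h𝒞.isFiniteFlat hX) (h𝒞.isFiniteFlat (ht.mem _ _))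
      (f ≫ (t i).toOne n) (by rw [reassoc_of% hf, hSE.comp_eq_zero, comp_zero])
    exact ⟨f, g, hf, hg, fun _ => rfl⟩
  · obtain ⟨f, hf⟩ := exists_extension_of_ne ht h𝒞 h hX' hX hij φ
    exact ⟨f ≫ (t i).incl n, 0, by rw [reassoc_of% hf], by
      rw [Category.assoc, hSE.comp_eq_zero, comp_zero, comp_zero], fun h => absurd rfl h⟩

/-- Because `g₀ ≠ 0`, some tower endomorphism carries `g₀` to `g`. The inequality `n ≤ n₀` allows
`f₀` to be projected to level `n + 1` without changing its obstruction; subtracting the resulting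
multiple kills the obstruction of `f`, so the difference lands in level `n`. -/
theorem exists_correction (ht : IsOrthogonal 𝒞 t) {n₀ : ℕ}
    {φ₀ : X' ⟶ (t j).obj n₀} {f₀ : X ⟶ (t j).obj (n₀ + 1)} {g₀ : (t j).obj 1 ⟶ (t j).obj 1}
    (hf₀ : inc ≫ f₀ = φ₀ ≫ (t j).incl n₀) (hπ₀ : π ≫ g₀ = f₀ ≫ (t j).toOne n₀) (hg₀ : g₀ ≠ 0)
    {i : I} {n : ℕ} {φ : X' ⟶ (t i).obj n} {f : X ⟶ (t i).obj (n + 1)}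
    {g : (t j).obj 1 ⟶ (t i).obj 1} (hf : inc ≫ f = φ ≫ (t i).incl n)
    (hπ : π ≫ g = f ≫ (t i).toOne n) (hg : g ≠ 0 → i = j ∧ n ≤ n₀) :
    ∃ (c : (t j).obj n₀ ⟶ (t i).obj n) (f' : X ⟶ (t i).obj n), inc ≫ f' = φ - φ₀ ≫ c := by
  have hSE := (ht.isExact i).isShortExact_incl n
  have := hSE.mono
  by_cases hg0 : g = 0
  · obtain ⟨f', hf'⟩ := hSE.exists_lift f (by rw [← hπ, hg0, comp_zero])
    exact ⟨0, f', by rw [← cancel_mono ((t i).incl n), Category.assoc, hf', hf]; simp⟩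
  · obtain ⟨rfl, hn⟩ := hg hg0
    obtain ⟨c, hc⟩ := ht.exists_endo i g₀ g hg₀
    obtain ⟨a, b, hab, hb⟩ := (ht.isExact i).exists_proj hn
    obtain ⟨f', hf'⟩ := hSE.exists_lift (f - f₀ ≫ b ≫ c.app (n + 1)) (by
      rw [Preadditive.sub_comp, Category.assoc, Category.assoc, c.app_toOne, reassoc_of% hb,
        ← reassoc_of% hπ₀, hc, hπ, sub_self])
    refine ⟨a ≫ c.app n, f', ?_⟩
    rw [← cancel_mono ((t i).incl n), Category.assoc, hf', Preadditive.comp_sub, hf,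
      reassoc_of% hf₀, reassoc_of% hab, c.incl_app]
    simp [Preadditive.sub_comp]

theorem isSumOfTowers_of_isShortExact (ht : IsOrthogonal 𝒞 t) (h𝒞 : IsSubquotientClosed 𝒞)
    (h : IsShortExact inc π) (hX' : 𝒞 X') (hX : 𝒞 X) (hsum : IsSumOfTowers t X') :
    IsSumOfTowers t X := by
  classical
  obtain ⟨J, _, a, n, hn, ⟨θ⟩⟩ := hsum
  have hXf := h𝒞.isFiniteFlat hX
  have hX'f := h𝒞.isFiniteFlat hX'
  have hQf := h𝒞.isFiniteFlat (ht.mem j 1)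
  let φ (s : J) : X' ⟶ (t (a s)).obj (n s) := θ.hom ≫ biproduct.π _ s
  choose f g hf hπ hg using fun s => ht.exists_obstruction h𝒞 h hX' hX (φ s)
  -- With no obstruction every coordinate extends, giving a retraction of `inc`, and `X` acquires a
  -- new summand at level `1`.
  by_cases hg0 : ∀ s, g s = 0
  · have key (s : J) : ∃ r : X ⟶ (t (a s)).obj (n s), inc ≫ r = φ s := by
      have hSE := (ht.isExact (a s)).isShortExact_incl (n s)
      have := hSE.mono
      obtain ⟨r, hr⟩ := hSE.exists_lift (f s) (by rw [← hπ, hg0, comp_zero])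
      exact ⟨r, by rw [← cancel_mono ((t (a s)).incl (n s)), Category.assoc, hr, hf]⟩
    choose r hr using key
    have hr' : inc ≫ biproduct.lift r = θ.hom := by
      apply biproduct.hom_ext
      intro s
      rw [Category.assoc, biproduct.lift_π, hr]
    have hi := h.isIso (isShortExact_biprod hX'f) hXf (hX'f.biprod hQf) hQf
      (biprod.lift (biproduct.lift r ≫ θ.inv) π) (𝟙 _) (𝟙 _) (by
        apply biprod.hom_ext
        · simp [reassoc_of% hr']
        · simp [h.comp_eq_zero]) (by simp)
    have : biprod.lift π (biproduct.lift r) =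
        biprod.lift (biproduct.lift r ≫ θ.inv) π ≫ (biprod.braiding _ _).hom ≫
          (biprod.mapIso (Iso.refl _) θ).hom := by
      apply biprod.hom_ext <;> simp
    have : IsIso (biprod.lift π (biproduct.lift r)) := by
      rw [this]
      infer_instance
    exact .of_iso_biprod hn j le_rfl (asIso (biprod.lift π (biproduct.lift r)))
  · push Not at hg0
    obtain ⟨s₁, hs₁⟩ := hg0
    -- Maximality of `n s₀` among the obstructed coordinates is the inequality that the correction
    -- step needs.
    obtain ⟨s₀, hs₀, hmax⟩ := Set.exists_max_image {s | g s ≠ 0} n (Set.toFinite _) ⟨s₁, hs₁⟩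
    obtain rfl := hg s₀ hs₀
    have key (s : J) := ht.exists_correction (hf s₀) (hπ s₀) hs₀ (hf s) (hπ s)
      fun hs => ⟨hg s hs, hmax s hs⟩
    choose c f' hf' using key
    obtain ⟨ψ, hψ⟩ := biproduct.exists_iso_biprod (fun s => (t (a s)).obj (n s)) s₀
      (Subtype.val : {s // s ≠ s₀} → J) Subtype.val_injective (fun s => s.2)
      (fun s hs => ⟨⟨s, hs⟩, rfl⟩)
    let v : X' ⟶ ⨁ fun s : {s // s ≠ s₀} => (t (a s)).obj (n s) := biproduct.lift fun s => φ s
    have hv : biprod.lift (φ s₀) v = θ.hom ≫ ψ.hom := by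
      rw [hψ]
      apply biprod.hom_ext
      · simp [φ]
      · apply biproduct.hom_ext
        intro s
        simp [φ, v]
    have : IsIso (biprod.lift (φ s₀) v) := by rw [hv]; infer_instance
    have := biprod.isIso_lift_sub (φ s₀) v (biproduct.lift fun s : {s // s ≠ s₀} => c s)
    have := Tower.isIso_of_ne_zero (ht.exists_endo _) hs₀
    have hW : IsFiniteFlat (⨁ fun s : {s // s ≠ s₀} => (t (a s)).obj (n s)) :=
      .biproduct fun s => h𝒞.isFiniteFlat (ht.mem _ _)
    -- The five lemma compares `X` with `X'` after the summand at `s₀` has been raised by one level: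
    -- the map on subobjects is a shear of the decomposition, and the map on quotients is the
    -- invertible `g s₀`.
    have hi := h.isIso (hW.isShortExact_biprod_map ((ht.isExact (a s₀)).isShortExact_incl (n s₀)))
      hXf ((h𝒞.isFiniteFlat (ht.mem _ _)).biprod hW) hQf
      (biprod.lift (f s₀) (biproduct.lift fun s : {s // s ≠ s₀} => f' s))
      (biprod.lift (φ s₀) (v - φ s₀ ≫ biproduct.lift fun s : {s // s ≠ s₀} => c s))
      (g s₀) (by
        apply biprod.hom_ext
        · simp [hf]
        · apply biproduct.hom_ext
          intro s
          simp [hf', v, Preadditive.sub_comp]) (by simp [hπ])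
    exact .of_iso_biprod (fun s : {s // s ≠ s₀} => hn s) (a s₀) (Nat.le_add_left 1 _)
      (asIso (biprod.lift (f s₀) (biproduct.lift fun s : {s // s ≠ s₀} => f' s)))

end IsOrthogonal

end CommGroupScheme

/-! ### Consequences of the hypotheses on `End G` and on `δ` -/

namespace PDivisibleGroup

variable {p : ℕ} {O : Type u} [CommRing O] {G : PDivisibleGroup p O} {R : Type w} [CommRing R]
  {e : R ≃+* End G} {ϖ : R}

/-- Level `n` is killed by `p ^ n`, so if `p` were invertible the identity would vanish on every
level. -/
theorem not_isUnit_natCast [Nontrivial R] (e : R ≃+* End G) : ¬ IsUnit (p : R) := by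
  rintro ⟨c, hc⟩
  have h : e 1 = 0 := by
    refine hom_ext fun n => ?_
    have h1 : (1 : R) = ((p ^ n : ℕ) : R) * (↑c⁻¹) ^ n := by
      rw [Nat.cast_pow, ← hc, ← mul_pow, Units.mul_inv, one_pow]
    rw [h1, app_mul, app_natCast, G.pow_smul_eq_zero, zero_comp]
    rfl
  exact one_ne_zero (e.injective (h.trans (map_zero e).symm))

theorem dvd_natCast [IsDomain R] [IsDiscreteValuationRing R] (e : R ≃+* End G)
    (hϖ : Irreducible ϖ) : ϖ ∣ (p : R) := by
  rw [← Ideal.mem_span_singleton, ← hϖ.maximalIdeal_eq, IsLocalRing.mem_maximalIdeal]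
  exact not_isUnit_natCast e

/-- A nonzero vector spans the one-dimensional `Hom` space, and the scalar lifts from the residue
field to `R`. The lift matters because `R` acts on all levels of the tower, not only on the first.
-/
theorem exists_torsionMap_eq [IsDomain R] [IsDiscreteValuationRing R] (hϖ : Irreducible ϖ)
    (hdim : homFinrank e ϖ = 1) {f₀ : G.torsion (e ϖ) 1 ⟶ G.torsion (e ϖ) 1} (hf₀ : f₀ ≠ 0)
    (f : G.torsion (e ϖ) 1 ⟶ G.torsion (e ϖ) 1) : ∃ r, f₀ ≫ torsionMap e ϖ 1 r = f := by
  have hmax : (Ideal.span {ϖ}).IsMaximal := by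
    rw [← hϖ.maximalIdeal_eq]
    infer_instance
  let _ : Field (R ⧸ Ideal.span {ϖ}) := Ideal.Quotient.field _
  let _ : Module (R ⧸ Ideal.span {ϖ}) (G.torsion (e ϖ) 1 ⟶ G.torsion (e ϖ) 1) :=
    Module.compHom _ (residueAction e ϖ)
  have h : Module.finrank (R ⧸ Ideal.span {ϖ}) (G.torsion (e ϖ) 1 ⟶ G.torsion (e ϖ) 1) = 1 := hdim
  obtain ⟨c, hc⟩ := (finrank_eq_one_iff_of_nonzero' f₀ hf₀).1 h f
  obtain ⟨r, rfl⟩ := Ideal.Quotient.mk_surjective c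
  exact ⟨r, hc⟩

/-- An element of `R` acts on the tower of the `G[ϖⁿ]`. -/
noncomputable def torsionEndo (hdvd : ϖ ∣ (p : R)) (r : R) :
    (torsionTower (e := e) hdvd).Endo where
  app n := torsionMap e ϖ n r
  incl_app n := torsionSucc_torsionMap e ϖ n r
  app_proj n := torsionMap_torsionProj hdvd n r

theorem exists_extension_torsionSucc {ϖ : End G} {𝒞 : ObjectProperty (CommGroupScheme O)}
    (E : Extension 𝒞 (G.torsion ϖ 1) (G.torsion ϖ 1)) {f : G.torsion ϖ 1 ⟶ G.torsion ϖ 1}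
    (hf : G.IsConnecting ϖ 𝒞 f (Quotient.mk _ E)) :
    ∃ h : E.mid ⟶ G.torsion ϖ 2, E.inc ≫ h = G.torsionSucc ϖ 1 := by
  obtain ⟨E', h, hE, hinc, -⟩ := hf
  obtain ⟨φ, hφ, -⟩ := Quotient.exact hE
  exact ⟨φ.inv ≫ h, by rw [← hφ, Category.assoc, φ.hom_inv_id_assoc, hinc]⟩

end PDivisibleGroup

open PDivisibleGroup

/-! ### The decomposition theorem -/

theorem theorem7p10 {O : Type u} [CommRing O] [IsDomain O] [IsNoetherianRing O] [CharZero O]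
    (p : ℕ) (hp : p.Prime)
    -- the full subcategory `𝒞` of finite flat commutative group schemes of `p`-power order
    (𝒞 : ObjectProperty (CommGroupScheme O))
    (h𝒞 : ∀ X, 𝒞 X → IsFiniteFlat X ∧ ∃ m, HasOrder X (p ^ m))
    (hprod : ∀ X Y, 𝒞 X → 𝒞 Y → 𝒞 (X ⨯ Y))
    (hsub : ∀ (X Y : CommGroupScheme O) (i : X ⟶ Y), IsClosedFlatSubgroup i → 𝒞 Y → 𝒞 X)
    (hquot : ∀ (X Y Z : CommGroupScheme O) (i : X ⟶ Y) (q : Y ⟶ Z), IsClosedFlatSubgroup i →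
      IsFiniteFlat Z → IsShortExact i q → 𝒞 Y → 𝒞 Z)
    -- the `p`-divisible groups `G i`, with `End (G i)` a discrete valuation ring
    {I : Type v} [Finite I] (G : I → PDivisibleGroup p O)
    (R : I → Type w) [∀ i, CommRing (R i)] [∀ i, IsDomain (R i)]
    [∀ i, IsDiscreteValuationRing (R i)] (e : ∀ i, R i ≃+* End (G i))
    (ϖ : ∀ i, R i) (hϖ : ∀ i, Irreducible (ϖ i))
    (htors : ∀ i n, 𝒞 ((G i).torsion (e i (ϖ i)) n))
    -- `δ` is an isomorphism of one-dimensional vector spaces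
    (hdim : ∀ i, PDivisibleGroup.homFinrank (e i) (ϖ i) = 1)
    (hδ : ∀ i (c : ExtIn 𝒞 ((G i).torsion (e i (ϖ i)) 1) ((G i).torsion (e i (ϖ i)) 1)),
      ∃! f, (G i).IsConnecting (e i (ϖ i)) 𝒞 f c)
    -- the extension groups between different indices are trivial
    (hext : ∀ i j, i ≠ j →
      Subsingleton (ExtIn 𝒞 ((G i).torsion (e i (ϖ i)) 1) ((G j).torsion (e j (ϖ j)) 1)))
    -- a group scheme in `𝒞` filtered by copies of the `G i [ϖ i]`
    (X : CommGroupScheme O) (hX : 𝒞 X)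
    (hfilt : HasFiltration (fun Q => ∃ i, Nonempty (Q ≅ (G i).torsion (e i (ϖ i)) 1)) X) :
    ∃ (r : ℕ) (a : Fin r → I) (n : Fin r → ℕ), (∀ s, 1 ≤ n s) ∧
      Nonempty (X ≅ ⨁ fun s => (G (a s)).torsion (e (a s) (ϖ (a s))) (n s)) := by
  have hcl : IsSubquotientClosed 𝒞 :=
    ⟨fun hX => (h𝒞 _ hX).1, fun hX hY => hprod _ _ hX hY, fun i hi hY => hsub _ _ i hi hY,
      fun i q hi hZ h hY => hquot _ _ _ i q hi hZ h hY⟩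
  have hdvd (i : I) : ϖ i ∣ (p : R i) := dvd_natCast (e i) (hϖ i)
  let t (i : I) : Tower O := torsionTower (e := e i) (hdvd i)
  have ht : IsOrthogonal 𝒞 t :=
    { isExact := fun i =>
        have ⟨_, hm⟩ := (h𝒞 _ (htors i 1)).2
        isExact_torsionTower hp (hdvd i) (fun n => (h𝒞 _ (htors i n)).1) hm
      mem := htors
      exists_endo := fun i f₀ f hf₀ =>
        have ⟨r, hr⟩ := exists_torsionMap_eq (hϖ i) (hdim i) hf₀ f
        ⟨torsionEndo (hdvd i) r, hr⟩
      exists_extension := fun i E κ q hE h =>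
        -- Surjectivity of `δ` exhibits the class of `E` as a pullback of the `ϖ²`-torsion, and the
        -- pullback comes with the required map.
        have ⟨_, hf, _⟩ := hδ i (Quotient.mk _ ⟨E, hE, κ, q, h⟩)
        exists_extension_torsionSucc _ hf
      exists_retraction := fun {i j} hij E κ q hE h =>
        have := hext j i hij.symm
        hcl.exists_retraction (htors j 1) (htors i 1) hE h }
  have key : IsSumOfTowers t X := by
    induction hfilt with
    | zero X hX0 => exact .of_isZero hX0
    | step i q hA hi hB h hQ ih =>
      obtain ⟨j, ⟨δ⟩⟩ := hQ
      have hA' := hsub _ _ i hi hX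
      -- The isomorphism `δ` replaces the abstract quotient by the bottom term of the tower `j`.
      exact ht.isSumOfTowers_of_isShortExact hcl (h.comp_isIso (𝟙 _) δ.hom) hA' hX (ih hA')
  obtain ⟨J, _, a, n, hn, ⟨θ⟩⟩ := key
  obtain ⟨r, ⟨ε⟩⟩ := Finite.exists_equiv_fin J
  refine ⟨r, a ∘ ε.symm, n ∘ ε.symm, fun s => hn _, ⟨θ ≪≫ ?_⟩⟩
  exact (biproduct.reindex ε.symm fun s => (t (a s)).obj (n s)).symm
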